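/- Let $A\in\mathcal M_{m\times n}(\mathbb Z)$, $\boldsymbol a\in\mathbb Z^m$, $B\in\mathcal M_{l\times n}(\mathbb Z)$, $\boldsymbol b\in\mathbb Z^l$. Let $V(B,\boldsymbol b)=\{\boldsymbol x\in\mathbb R^n: B\boldsymbol x=\boldsymbol b\}$, let $H_i^{(B,\boldsymbol b)}$ be the set of $\boldsymbol x\in V(B,\boldsymbol b)$ that satisfy the $i$-th equation of $A\boldsymbol x=\boldsymbol a$, and let $\mathcal A^{(B,\boldsymbol b)}=\{H_1^{(B,\boldsymbol b)},\dots,H_m^{(B,\boldsymbol b)}\}$. For $q\in\mathbb Z_{>0}$ let $M(\mathcal A_q^{(B,\boldsymbol b)})$ be the set of $\boldsymbol x\in(\mathbb Z/q\mathbb Z)^n$ such that $B\boldsymbol x=\boldsymbol b$ modulo $q$ and $\boldsymbol x$ satisfies none of the $m$ equations of $A\boldsymbol x=\boldsymbol a$ modulo $q$. For $J\subseteq[m]$ let $A_J,\boldsymbol a_J$ consist of the rows of $A$ and the entries of $\boldsymbol a$ indexed by $J$, and put $C_J=\begin{bmatrix}B\\A_J\end{bmatrix}$, $\boldsymbol c_J=\begin{bmatrix}\boldsymbol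 b\\\boldsymbol a_J\end{bmatrix}$, $\bar C_J=[C_J\ \boldsymbol c_J]$, $r(J)=\operatorname{rank}C_J$, $\bar r(J)=\operatorname{rank}\bar C_J$. Let $d_{J,1}\mid\cdots\mid d_{J,r(J)}$ and $\bar d_{J,1}\mid\cdots\mid\bar d_{J,\bar r(J)}$ be the invariant factors (the positive diagonal entries of the Smith normal form) of $C_J$ and $\bar C_J$, and put $d_{J,\bar r(J)}=0$ if $\bar r(J)=r(J)+1$. Let $r=r(\emptyset)$, $s=r([m])$, $$\rho_C=\operatorname{lcm}\{d_{J,r(J)}:\bar r(J)=r(J)\},\qquad q_0=\max\{\bar d_{J,\bar r(J)}:\bar r(J)=r(J)+1\},$$ where $d_{J,r(J)}$ is read as $1$ if $r(J)=0$, and $q_0=0$ if there is no $J$ with $\bar r(J)=r(J)+1$. For $q\in\mathbb Z_{>0}$ let $\tilde d_J(q)=\prod_{j=1}^{r(J)}\gcd(d_{J,j},q)$ if $\gcd(q,d_{J,j})=\gcd(q,\bar d_{J,j})$ for all $1\le j\le\bar r(J)$, and $\tilde d_J(q)=0$ otherwise. For $r\le j\le s$ let $$\beta_j(q)=(-1)^{j-r}\sum_{J\subseteq[m],\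 \bar r(J)=r(J)=j}(-1)^{\#J}\,\tilde d_J(q)\quad(q\ge1),$$ and let $\gamma_j(a)$ be given by the same formula with $q$ replaced by $a$, for $1\le a\le\rho_C$. For $1\le a\le\rho_C$ the $a$-th constituent $f_a\in\mathbb Q[t]$ is the polynomial such that $f_a(q)=\#M(\mathcal A_q^{(B,\boldsymbol b)})$ for all integers $q>q_0$ with $q\equiv a\pmod{\rho_C}$. Fix any linear order on $\mathcal A^{(B,\boldsymbol b)}$. A subset of $\mathcal A^{(B,\boldsymbol b)}$ is central if its members have a common point in $V(B,\boldsymbol b)$, and dependent if it is central and the codimension in $V(B,\boldsymbol b)$ of its intersection is less than its cardinality (the empty intersection being $V(B,\boldsymbol b)$). A circuit is a minimal dependent set, and a broken circuit is a circuit with its largest element removed. For $r\le j\le s$ let $w_j$ be the number of central subsets of $\mathcal A^{(B,\boldsymbol b)}$ with $j-r$ elements that contain no broken circuit. **Statement.** Suppose that $V(B,\boldsymbol b)\neq\emptyset$ and that every $H_i^{(B,\boldsymbol b)}$ is a nonempty affine subspace of codimension one in $V(B,\boldsymbol b)$. Let $q>q_0$ and $1\le a\le\rho_C$ be integers with $\gcd(q,\rho_C)=\gcd(a,\rho_C)$,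 and suppose that for every $J\subseteq[m]$ with $\bar r(J)=r(J)$ the vector $\boldsymbol c_J$ modulo $q$ lies in the $\mathbb Z/q\mathbb Z$-module generated by the columns of $C_J$ modulo $q$. Then $$0<w_j=\gamma_j(1)\le\gamma_j(a)=\beta_j(q)\qquad\text{for all } r\le j\le s .$$ Hence the constituent $f_a$, which exists and is unique, is $f_a(t)=\sum_{j=r}^{s}(-1)^{j-r}\gamma_j(a)\,t^{n-j}$, and its coefficients of $t^{n-r},t^{n-r-1},\dots,t^{n-s}$ are nonzero and alternate in sign, beginning with a positive one. Moreover, if $\boldsymbol a=\boldsymbol 0$ and $\boldsymbol b=\boldsymbol 0$, then the same conclusions hold for all integers $q\ge1$ and $1\le a\le\rho_C$ with $\gcd(q,\rho_C)=\gcd(a,\rho_C)$, without the assumption on the vectors $\boldsymbol c_J$. -/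

import Mathlib

open Matrix Module

/-- The rank of an integral matrix (over the field of rational numbers). -/
noncomputable def intRank {ι κ : Type} [Fintype κ] (M : Matrix ι κ ℤ) : ℕ :=
  (M.map (Int.cast : ℤ → ℚ)).rank

/-- `d 0 ∣ d 1 ∣ ⋯ ∣ d (r - 1)`, with `r` the rank of `M`, are the invariant factors of the integral
matrix `M`, and `d k = 0` for `k ≥ r`.  There are unimodular matrices `P`, `Q` such that `P M Q` is
in Smith normal form.  As the rows and the columns of `M` are indexed by arbitrary finite types, the
positions of the diagonal entries are recorded by embeddings of `Fin r` into the index types. -/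
def IsInvariantFactors {ι κ : Type} [Fintype ι] [DecidableEq ι] [Fintype κ] [DecidableEq κ]
    (M : Matrix ι κ ℤ) (d : ℕ → ℕ) : Prop :=
  (∀ k, k < intRank M → 0 < d k) ∧
  (∀ k, intRank M ≤ k → d k = 0) ∧
  (∀ k, d k ∣ d (k + 1)) ∧
  ∃ (P : (Matrix ι ι ℤ)ˣ) (Q : (Matrix κ κ ℤ)ˣ) (e : Fin (intRank M) ↪ ι)
    (f : Fin (intRank M) ↪ κ),
    (P : Matrix ι ι ℤ) * M * (Q : Matrix κ κ ℤ) =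
      ∑ k : Fin (intRank M), Matrix.single (e k) (f k) (d k : ℤ)

open Classical in
/-- The invariant factors of `M`: `invFactor M k` is the `(k + 1)`-st one for `k < rank M`, and `0`
for `k ≥ rank M`.  (By the elementary divisor theorem they exist and are unique.) -/
noncomputable def invFactor {ι κ : Type} [Fintype ι] [DecidableEq ι] [Fintype κ] [DecidableEq κ]
    (M : Matrix ι κ ℤ) : ℕ → ℕ :=
  if h : ∃ d, IsInvariantFactors M d then h.choose else 0

/-- The largest invariant factor of `M`, with the usual convention that it is `1` if `M` has
rank `0` (that is, if `M` has no invariant factors). -/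
noncomputable def maxInvFactor {ι κ : Type} [Fintype ι] [DecidableEq ι] [Fintype κ]
    [DecidableEq κ] (M : Matrix ι κ ℤ) : ℕ :=
  if intRank M = 0 then 1 else invFactor M (intRank M - 1)

/-- The reduction modulo `q` of an integral matrix. -/
def matMod (q : ℕ) {ι κ : Type} (M : Matrix ι κ ℤ) : Matrix ι κ (ZMod q) :=
  M.map (Int.cast : ℤ → ZMod q)

/-- The reduction modulo `q` of an integral vector. -/
def vecMod (q : ℕ) {ι : Type} (c : ι → ℤ) : ι → ZMod q := fun i => (c i : ZMod q)

/-- The module `Col_q(M)` generated over `ℤ/qℤ` by the columns of `M` modulo `q`. -/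
def colSpaceMod (q : ℕ) {ι κ : Type} (M : Matrix ι κ ℤ) : Submodule (ZMod q) (ι → ZMod q) :=
  Submodule.span (ZMod q) (Set.range (matMod q M).col)

/-- The real solution space of the integral linear system `M x = c`. -/
def solSpace {ι : Type} {n : ℕ} (M : Matrix ι (Fin n) ℤ) (c : ι → ℤ) :
    AffineSubspace ℝ (Fin n → ℝ) where
  carrier := {x | M.map (Int.cast : ℤ → ℝ) *ᵥ x = fun i => (c i : ℝ)}
  smul_vsub_vadd_mem' := by
    intro t x y z hx hy hz
    simp only [Set.mem_ofPred_eq] at hx hy hz ⊢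
    simp [Matrix.mulVec_add, Matrix.mulVec_smul, Matrix.mulVec_sub, hx, hy, hz]

/-! ### Arrangements of affine subspaces and broken circuits -/

section BrokenCircuits

variable {n : ℕ}

/-- `X` is a (nonempty) affine subspace of codimension one in `V`. -/
def IsCodimOne (X V : AffineSubspace ℝ (Fin n → ℝ)) : Prop :=
  X ≤ V ∧ (X : Set (Fin n → ℝ)).Nonempty ∧ finrank ℝ X.direction + 1 = finrank ℝ V.direction

/-- The intersection of the members of `S` inside the ambient space `V` (it is `V` if `S = ∅`). -/
noncomputable def interIn (V : AffineSubspace ℝ (Fin n → ℝ))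
    (S : Finset (AffineSubspace ℝ (Fin n → ℝ))) : AffineSubspace ℝ (Fin n → ℝ) :=
  V ⊓ S.inf id

/-- `S` is central: its members have a common point in `V`. -/
def IsCentralIn (V : AffineSubspace ℝ (Fin n → ℝ))
    (S : Finset (AffineSubspace ℝ (Fin n → ℝ))) : Prop :=
  (interIn V S : Set (Fin n → ℝ)).Nonempty

/-- `S` is dependent: it is central, and the codimension in `V` of its intersection is less than
its number of members. -/
def IsDependentIn (V : AffineSubspace ℝ (Fin n → ℝ))
    (S : Finset (AffineSubspace ℝ (Fin n → ℝ))) : Prop :=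
  IsCentralIn V S ∧ finrank ℝ V.direction < finrank ℝ (interIn V S).direction + S.card

/-- A circuit of the arrangement `𝓐` in `V` is a minimal dependent subset of `𝓐`. -/
def IsCircuitIn (V : AffineSubspace ℝ (Fin n → ℝ))
    (𝓐 C : Finset (AffineSubspace ℝ (Fin n → ℝ))) : Prop :=
  C ⊆ 𝓐 ∧ IsDependentIn V C ∧ ∀ D, D ⊂ C → ¬ IsDependentIn V D

/-- A broken circuit, with respect to the strict linear order `prec`, is a circuit with its largest
element removed. -/
def IsBrokenCircuitIn (prec : AffineSubspace ℝ (Fin n → ℝ) → AffineSubspace ℝ (Fin n → ℝ) → Prop)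
    (V : AffineSubspace ℝ (Fin n → ℝ)) (𝓐 T : Finset (AffineSubspace ℝ (Fin n → ℝ))) : Prop :=
  ∃ C, IsCircuitIn V 𝓐 C ∧ ∃ H ∈ C, (∀ K ∈ C, K ≠ H → prec K H) ∧
    (T : Set (AffineSubspace ℝ (Fin n → ℝ))) = (C : Set (AffineSubspace ℝ (Fin n → ℝ))) \ {H}

/-- The number of central `k`-element subsets of the arrangement `𝓐` in `V` that contain no broken
circuit. -/
noncomputable def nbcCount
    (prec : AffineSubspace ℝ (Fin n → ℝ) → AffineSubspace ℝ (Fin n → ℝ) → Prop)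
    (V : AffineSubspace ℝ (Fin n → ℝ)) (𝓐 : Finset (AffineSubspace ℝ (Fin n → ℝ))) (k : ℕ) : ℕ :=
  Set.ncard {S : Finset (AffineSubspace ℝ (Fin n → ℝ)) |
    S ⊆ 𝓐 ∧ S.card = k ∧ IsCentralIn V S ∧ ∀ T, IsBrokenCircuitIn prec V 𝓐 T → ¬ T ⊆ S}

end BrokenCircuits

/-! ### Truncated integral arrangements -/

/-- The data of a truncated integral arrangement: the `m` hyperplanes in `ℝⁿ` given by the rows of
`A x = a`, restricted to the solution space of the `l` equations `B x = b`. -/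
structure TruncatedArrangement (l m n : ℕ) where
  /-- normal vectors of the hyperplanes -/
  A : Matrix (Fin m) (Fin n) ℤ
  /-- right-hand sides of the hyperplanes -/
  a : Fin m → ℤ
  /-- coefficients of the truncating system -/
  B : Matrix (Fin l) (Fin n) ℤ
  /-- right-hand sides of the truncating system -/
  b : Fin l → ℤ

namespace TruncatedArrangement

variable {l m n : ℕ} (𝒯 : TruncatedArrangement l m n)

/-- The ambient space `V(B, b)`. -/
def V : AffineSubspace ℝ (Fin n → ℝ) := solSpace 𝒯.B 𝒯.b

/-- The subspace `H_i ∩ V(B, b)`, where `H_i` is the hyperplane `A_i x = a_i`. -/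
def H (i : Fin m) : AffineSubspace ℝ (Fin n → ℝ) :=
  solSpace (𝒯.A.submatrix (fun _ : Unit => i) id) (fun _ => 𝒯.a i) ⊓ 𝒯.V

open Classical in
/-- The truncated arrangement, a finite set of affine subspaces of `V(B, b)`. -/
noncomputable def arr : Finset (AffineSubspace ℝ (Fin n → ℝ)) := Finset.univ.image 𝒯.H

/-- The matrix `C_J`: the rows of `B`, followed by the rows of `A` with index in `J`. -/
def C (J : Finset (Fin m)) : Matrix (Fin l ⊕ J) (Fin n) ℤ :=
  Matrix.fromRows 𝒯.B (𝒯.A.submatrix (fun i : J => (i : Fin m)) id)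

/-- The vector `c_J`: the entries of `b`, followed by the entries of `a` with index in `J`. -/
def c (J : Finset (Fin m)) : Fin l ⊕ J → ℤ := Sum.elim 𝒯.b (fun i : J => 𝒯.a i)

/-- The augmented matrix `[C_J, c_J]`. -/
def CBar (J : Finset (Fin m)) : Matrix (Fin l ⊕ J) (Fin n ⊕ Unit) ℤ :=
  Matrix.fromCols (𝒯.C J) (Matrix.replicateCol Unit (𝒯.c J))

/-- `r(J) = rank C_J`. -/
noncomputable def r (J : Finset (Fin m)) : ℕ := intRank (𝒯.C J)

/-- `r̄(J) = rank [C_J, c_J]`. -/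
noncomputable def rBar (J : Finset (Fin m)) : ℕ := intRank (𝒯.CBar J)

/-- The lcm period `ρ_C`, the least common multiple of the largest invariant factors of the matrices
`C_J` with `r̄(J) = r(J)`. -/
noncomputable def rho : ℕ :=
  (Finset.univ.filter fun J : Finset (Fin m) => 𝒯.rBar J = 𝒯.r J).lcm
    fun J => maxInvFactor (𝒯.C J)

/-- The bound `q₀`, the maximum of the largest invariant factors of the matrices `[C_J, c_J]` with
`r̄(J) = r(J) + 1` (and `0` if there is no such `J`). -/
noncomputable def q0 : ℕ :=
  (Finset.univ.filter fun J : Finset (Fin m) => 𝒯.rBar J = 𝒯.r J + 1).sup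
    fun J => maxInvFactor (𝒯.CBar J)

open Classical in
/-- `d̃_J(q)`: the product of the `gcd(d_{J,j}, q)` over `j = 1, …, r(J)` if
`gcd(q, d_{J,j}) = gcd(q, d̄_{J,j})` for `j = 1, …, r̄(J)`, and `0` otherwise. -/
noncomputable def dTilde (J : Finset (Fin m)) (q : ℕ) : ℕ :=
  if ∀ j < 𝒯.rBar J, q.gcd (invFactor (𝒯.C J) j) = q.gcd (invFactor (𝒯.CBar J) j) then
    ∏ j ∈ Finset.range (𝒯.r J), (invFactor (𝒯.C J) j).gcd q
  else 0

/-- The unsigned coefficient `β_j(q)` of `q^(n-j)` in the characteristic quasi-polynomial, for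
`j ≥ rank B`. -/
noncomputable def beta (j q : ℕ) : ℤ :=
  (-1) ^ (j - 𝒯.r ∅) *
    ∑ J ∈ Finset.univ.filter fun J : Finset (Fin m) => 𝒯.rBar J = 𝒯.r J ∧ 𝒯.r J = j,
      (-1) ^ J.card * (𝒯.dTilde J q : ℤ)

/-- The unsigned coefficient `γ_j(k)` of `t^(n-j)` in the `k`-th constituent, for `j ≥ rank B`. -/
noncomputable def gamma (j k : ℕ) : ℤ :=
  (-1) ^ (j - 𝒯.r ∅) *
    ∑ J ∈ Finset.univ.filter fun J : Finset (Fin m) => 𝒯.rBar J = 𝒯.r J ∧ 𝒯.r J = j,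
      (-1) ^ J.card * (𝒯.dTilde J k : ℤ)

/-- The complement of the reduction of the arrangement modulo `q`. -/
def complMod (q : ℕ) : Set (Fin n → ZMod q) :=
  {x | matMod q 𝒯.B *ᵥ x = vecMod q 𝒯.b ∧ ∀ i, (matMod q 𝒯.A *ᵥ x) i ≠ vecMod q 𝒯.a i}

/-- `f` is the `k`-th constituent of the characteristic quasi-polynomial, the quasi-polynomial with
period `ρ_C` that counts the points of the complement modulo `q` for all `q > q₀`. -/
def IsConstituent (k : ℕ) (f : Polynomial ℚ) : Prop :=
  ∀ q : ℕ, 𝒯.q0 < q → q ≡ k [MOD 𝒯.rho] → f.eval (q : ℚ) = ((𝒯.complMod q).ncard : ℚ)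

/-- `w_j`: the number of central subsets with `j - rank B` members of the truncated arrangement that
contain no broken circuit. -/
noncomputable def w
    (prec : AffineSubspace ℝ (Fin n → ℝ) → AffineSubspace ℝ (Fin n → ℝ) → Prop) (j : ℕ) : ℕ :=
  nbcCount prec 𝒯.V 𝒯.arr (j - 𝒯.r ∅)

end TruncatedArrangement

/-! By inclusion and exclusion, the complement modulo `q` is counted by the sum over `J` of
`(-1)^#J` times the number of solutions of `C_J x = c_J` modulo `q`. A Smith normal form decouples
the homogeneous system into equations `d_j y_j = 0`, so a solvable system has `∏ gcd(d_j, q) * q^(n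
- r(J))` solutions, and solvability itself is a comparison of greatest common divisors
(`mem_colSpaceMod_iff_gcd`). An inconsistent `J` contributes nothing for `q > q₀`. For a consistent
`J`, solvability and the product depend only on `gcd(q, ρ_C)`. Grouping by rank gives the
constituent (`ncard_complMod_eq_sum_beta`, `isConstituent_constituent`).

For `q = 1` every product is `1`, so `γ_j(1)` is a signed count of consistent `J` of rank `j`.
Whitney's broken circuit theorem (`sum_centralOfCodim`) turns this into `w_j`. It is positive
because every rank between `r` and `s` occurs (`exists_central`) and every flat is the intersection
of an independent set without broken circuits (`nbcCount_pos`).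

For `γ_j(1) ≤ β_j(q)`, multiply by `q^(n-j)`: then `d̃_J(q) q^(n-j)` counts the `x` with `C_J x = 0`
modulo `q`. Group the `J` by their flat, let `Z` be the set of hyperplanes through it, and sum over
`x` first. If `Y(x)` denotes the rows of `A` that annihilate `x`, then each `x` with `B x = 0`
contributes the signed count of the consistent rank-`j` subsets of `Z ∩ Y(x)`. By Whitney's theorem
for the subarrangement this is nonnegative after the sign correction. At least `q^(n-j)` points
satisfy `Z ⊆ Y(x)` and contribute the full count of the flat (`pow_mul_sum_le_sum_kerCount`). -/

/-- `M` can be brought into Smith normal form with diagonal entries `d 0, …, d (r - 1)`. -/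
def HasSmithForm {ι κ : Type} [Fintype ι] [DecidableEq ι] [Fintype κ] [DecidableEq κ]
    (M : Matrix ι κ ℤ) (r : ℕ) (d : ℕ → ℕ) : Prop :=
  (∀ k, k < r → 0 < d k) ∧ (∀ k, r ≤ k → d k = 0) ∧ (∀ k, d k ∣ d (k + 1)) ∧
  ∃ (P : (Matrix ι ι ℤ)ˣ) (Q : (Matrix κ κ ℤ)ˣ) (e : Fin r ↪ ι) (f : Fin r ↪ κ),
    (P : Matrix ι ι ℤ) * M * (Q : Matrix κ κ ℤ) =
      ∑ k : Fin r, Matrix.single (e k) (f k) (d k : ℤ)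

/-! ### Smith normal form of integral matrices. -/

section Smith

variable {ι κ : Type} [Fintype ι] [DecidableEq ι] [Fintype κ] [DecidableEq κ]

theorem HasSmithForm.of_mul {M : Matrix ι κ ℤ} {r : ℕ} {d : ℕ → ℕ} (P : (Matrix ι ι ℤ)ˣ)
    (Q : (Matrix κ κ ℤ)ˣ)
    (h : HasSmithForm ((P : Matrix ι ι ℤ) * M * (Q : Matrix κ κ ℤ)) r d) :
    HasSmithForm M r d := by
  obtain ⟨h1, h2, h3, P', Q', e, f, h4⟩ := h
  refine ⟨h1, h2, h3, P' * P, Q * Q', e, f, ?_⟩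
  rw [← h4]
  simp [Matrix.mul_assoc]

theorem HasSmithForm.of_submatrix {ι' κ' : Type} [Fintype ι'] [DecidableEq ι'] [Fintype κ']
    [DecidableEq κ'] {M : Matrix ι κ ℤ} {r : ℕ} {d : ℕ → ℕ} (σ : ι' ≃ ι) (τ : κ' ≃ κ)
    (h : HasSmithForm (M.submatrix σ τ) r d) : HasSmithForm M r d := by
  obtain ⟨h1, h2, h3, P, Q, e, f, h4⟩ := h
  refine ⟨h1, h2, h3, Units.map (Matrix.reindexAlgEquiv ℤ ℤ σ).toMonoidHom P,
    Units.map (Matrix.reindexAlgEquiv ℤ ℤ τ).toMonoidHom Q, e.trans σ.toEmbedding,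
    f.trans τ.toEmbedding, ?_⟩
  have hM : M = Matrix.reindex σ τ (M.submatrix σ τ) := by
    ext i j; simp
  have h5 := congrArg (Matrix.reindex σ τ) h4
  have h6 : ((Units.map (Matrix.reindexAlgEquiv ℤ ℤ σ).toMonoidHom P : (Matrix ι ι ℤ)ˣ) :
      Matrix ι ι ℤ) * M * ((Units.map (Matrix.reindexAlgEquiv ℤ ℤ τ).toMonoidHom Q :
      (Matrix κ κ ℤ)ˣ) : Matrix κ κ ℤ) =
      Matrix.reindex σ τ ((P : Matrix ι' ι' ℤ) * (M.submatrix σ τ) * (Q : Matrix κ' κ' ℤ)) := by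
    have h7 : ((Matrix.reindexAlgEquiv ℤ ℤ σ) (P : Matrix ι' ι' ℤ)) * Matrix.reindex σ τ
        (M.submatrix σ τ) * ((Matrix.reindexAlgEquiv ℤ ℤ τ) (Q : Matrix κ' κ' ℤ)) =
        Matrix.reindex σ τ ((P : Matrix ι' ι' ℤ) * (M.submatrix σ τ) * (Q : Matrix κ' κ' ℤ)) := by
      simp only [Matrix.coe_reindexAlgEquiv, Matrix.reindex_apply, Matrix.submatrix_mul_equiv]
    rw [← hM] at h7
    exact h7
  rw [h6, h5]
  ext i j
  simp only [Matrix.reindex_apply, Matrix.submatrix_apply, Matrix.sum_apply, Matrix.single_apply]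
  refine Finset.sum_congr rfl fun k _ => ?_
  simp [Equiv.eq_symm_apply]

theorem HasSmithForm.zero : HasSmithForm (0 : Matrix ι κ ℤ) 0 (fun _ => 0) := by
  refine ⟨by simp, by simp, by simp, 1, 1, ⟨Fin.elim0, fun i => i.elim0⟩,
    ⟨Fin.elim0, fun i => i.elim0⟩, by simp⟩

/-- Bordering a matrix by a pivot that divides its content. -/
theorem HasSmithForm.fromBlocks {M : Matrix ι κ ℤ} {r : ℕ} {d : ℕ → ℕ} (h : HasSmithForm M r d)
    {g : ℕ} (hg : 0 < g) :
    HasSmithForm (Matrix.fromBlocks (Matrix.of fun _ _ : Unit => (g : ℤ)) 0 0 ((g : ℤ) • M)) (r + 1)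
      (fun k => if k = 0 then g else g * d (k - 1)) := by
  obtain ⟨h1, h2, h3, P, Q, e, f, h4⟩ := h
  refine ⟨?_, ?_, ?_, ⟨Matrix.fromBlocks 1 0 0 (P : Matrix ι ι ℤ),
    Matrix.fromBlocks 1 0 0 ((P⁻¹ : (Matrix ι ι ℤ)ˣ) : Matrix ι ι ℤ), ?_, ?_⟩,
    ⟨Matrix.fromBlocks 1 0 0 (Q : Matrix κ κ ℤ),
    Matrix.fromBlocks 1 0 0 ((Q⁻¹ : (Matrix κ κ ℤ)ˣ) : Matrix κ κ ℤ), ?_, ?_⟩,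
    ⟨Fin.cons (Sum.inl ()) (Sum.inr ∘ e), ?_⟩, ⟨Fin.cons (Sum.inl ()) (Sum.inr ∘ f), ?_⟩, ?_⟩
  · intro k hk
    rcases k with _ | k
    · simpa
    · simpa using ⟨hg, h1 k (by omega)⟩
  · intro k hk
    rcases k with _ | k
    · omega
    · simpa using Or.inr (h2 k (by omega))
  · intro k
    rcases k with _ | k
    · simp
    · simpa using Nat.mul_dvd_mul_left g (h3 k)
  · simp [Matrix.fromBlocks_multiply]
  · simp [Matrix.fromBlocks_multiply]
  · simp [Matrix.fromBlocks_multiply]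
  · simp [Matrix.fromBlocks_multiply]
  · rw [Fin.cons_injective_iff]
    exact ⟨by simp, Sum.inr_injective.comp e.injective⟩
  · rw [Fin.cons_injective_iff]
    exact ⟨by simp, Sum.inr_injective.comp f.injective⟩
  · rw [Fin.sum_univ_succ]
    simp only [Matrix.fromBlocks_multiply]
    simp only [Matrix.one_mul, Matrix.mul_one, Matrix.zero_mul, Matrix.mul_zero, add_zero,
      zero_add, Matrix.mul_smul, Matrix.smul_mul, h4]
    ext (i | i) (j | j)
    · simp [Matrix.sum_apply]
    · simp [Matrix.sum_apply]
    · simp [Matrix.sum_apply]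
    · simp [Matrix.sum_apply, Matrix.single_apply, Finset.mul_sum]

/-- An entry that is minimal among the nonzero entries of all equivalent matrices divides all
entries. -/
theorem pivot_dvd {M : Matrix ι κ ℤ} {g : ℕ} {i : ι} {j : κ} (hij : M i j = g) (hg : 0 < g)
    (hmin : ∀ (P : (Matrix ι ι ℤ)ˣ) (Q : (Matrix κ κ ℤ)ˣ) i' j',
      ((P : Matrix ι ι ℤ) * M * (Q : Matrix κ κ ℤ)) i' j' ≠ 0 →
      g ≤ (((P : Matrix ι ι ℤ) * M * (Q : Matrix κ κ ℤ)) i' j').natAbs) (i' : ι) (j' : κ) :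
    (g : ℤ) ∣ M i' j' := by
  have tr : ∀ {α : Type} [Fintype α] [DecidableEq α] (x y : α) (hxy : x ≠ y) (c : ℤ),
      ∃ T : (Matrix α α ℤ)ˣ, (T : Matrix α α ℤ) = Matrix.transvection x y c := by
    intro α _ _ x y hxy c
    have : IsUnit (Matrix.transvection x y c) := by
      rw [Matrix.isUnit_iff_isUnit_det, Matrix.det_transvection_of_ne x y hxy]
      exact isUnit_one
    exact ⟨this.unit, rfl⟩
  -- A nonzero remainder modulo `g` would be smaller than `g`, against minimality.
  have hrem : ∀ z : ℤ, (z % g ≠ 0 → g ≤ (z % g).natAbs) → (g : ℤ) ∣ z := by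
    intro z hz
    by_contra hdvd
    have h0 : z % g ≠ 0 := fun h => hdvd (Int.dvd_of_emod_eq_zero h)
    have h1 := hz h0
    have h2 := Int.emod_nonneg z (b := (g : ℤ)) (by omega)
    have h3 := Int.emod_lt_of_pos z (b := (g : ℤ)) (by omega)
    omega
  -- Stated for all equivalent matrices that keep the pivot, since it is applied again after row
  -- operations.
  have row : ∀ (P : (Matrix ι ι ℤ)ˣ) (Q : (Matrix κ κ ℤ)ˣ),
      ((P : Matrix ι ι ℤ) * M * (Q : Matrix κ κ ℤ)) i j = g → ∀ j',
      (g : ℤ) ∣ ((P : Matrix ι ι ℤ) * M * (Q : Matrix κ κ ℤ)) i j' := by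
    intro P Q hPQ j'
    by_cases hj : j' = j
    · rw [hj, hPQ]
    set z := ((P : Matrix ι ι ℤ) * M * (Q : Matrix κ κ ℤ)) i j' with hz
    obtain ⟨T, hT⟩ := tr j j' (Ne.symm hj) (-(z / g))
    have := hmin P (Q * T) i j'
    rw [Units.val_mul, ← Matrix.mul_assoc, hT, Matrix.mul_transvection_apply_same, hPQ, ← hz] at this
    apply hrem
    rwa [show z + -(z / g) * (g : ℤ) = z % g by have := Int.emod_add_mul_ediv z g; linarith] at this
  have col : ∀ i', (g : ℤ) ∣ M i' j := by
    intro i'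
    by_cases hi : i' = i
    · rw [hi, hij]
    obtain ⟨T, hT⟩ := tr i' i hi (-(M i' j / g))
    have := hmin T 1 i' j
    rw [Units.val_one, Matrix.mul_one, hT, Matrix.transvection_mul_apply_same, hij] at this
    apply hrem
    rwa [show M i' j + -(M i' j / g) * (g : ℤ) = M i' j % g by
      have := Int.emod_add_mul_ediv (M i' j) g; linarith] at this
  have row1 : ∀ j', (g : ℤ) ∣ M i j' := by
    intro j'
    simpa using row 1 1 (by simpa using hij) j'
  by_cases hi : i' = i
  · rw [hi]; exact row1 j'
  obtain ⟨u, hu⟩ := col i'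
  -- Clearing the entry below the pivot and then adding row `i'` to row `i` keeps the pivot `g` and
  -- moves the entries of row `i'` into the pivot row, where `row` applies.
  obtain ⟨T, hT⟩ := tr i' i hi (-u)
  obtain ⟨T', hT'⟩ := tr i i' (Ne.symm hi) 1
  have key : ∀ j', ((((T' * T : (Matrix ι ι ℤ)ˣ)) : Matrix ι ι ℤ) * M *
      ((1 : (Matrix κ κ ℤ)ˣ) : Matrix κ κ ℤ)) i j' = M i j' + (M i' j' - u * M i j') := by
    intro j'
    rw [Units.val_one, Matrix.mul_one, Units.val_mul, Matrix.mul_assoc, hT',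
      Matrix.transvection_mul_apply_same, hT, Matrix.transvection_mul_apply_same,
      Matrix.transvection_mul_apply_of_ne _ _ _ _ (Ne.symm hi)]
    ring
  have h2 := row (T' * T) 1 (by rw [key, hij, hu]; ring) j'
  rw [key] at h2
  have h3 := row1 j'
  have : M i' j' = (M i j' + (M i' j' - u * M i j')) - (1 - u) * M i j' := by ring
  rw [this]
  exact dvd_sub h2 (h3.mul_left _)

end Smith

/-- The elementary divisor theorem for integral matrices. -/
theorem exists_hasSmithForm (N : ℕ) : ∀ {ι κ : Type} [Fintype ι] [DecidableEq ι] [Fintype κ]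
    [DecidableEq κ] (M : Matrix ι κ ℤ), Fintype.card ι = N → ∃ r d, HasSmithForm M r d := by
  induction N with
  | zero =>
    intro ι κ _ _ _ _ M hN
    have : IsEmpty ι := Fintype.card_eq_zero_iff.mp hN
    have hM : M = 0 := by ext i; exact this.elim i
    exact ⟨0, _, hM ▸ HasSmithForm.zero⟩
  | succ N ih =>
    intro ι κ _ _ _ _ M hN
    by_cases hM : M = 0
    · exact ⟨0, _, hM ▸ HasSmithForm.zero⟩
    classical
    -- The least positive entry of all equivalent matrices will be the first invariant factor;
    -- replacing `P` by `-P` makes a negative entry positive.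
    let S : Set ℕ := {g | 0 < g ∧ ∃ (P : (Matrix ι ι ℤ)ˣ) (Q : (Matrix κ κ ℤ)ˣ) (i : ι) (j : κ),
      ((P : Matrix ι ι ℤ) * M * (Q : Matrix κ κ ℤ)) i j = g}
    have habs : ∀ (P : (Matrix ι ι ℤ)ˣ) (Q : (Matrix κ κ ℤ)ˣ) (i : ι) (j : κ),
        ((P : Matrix ι ι ℤ) * M * (Q : Matrix κ κ ℤ)) i j ≠ 0 →
        (((P : Matrix ι ι ℤ) * M * (Q : Matrix κ κ ℤ)) i j).natAbs ∈ S := by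
      intro P Q i j h
      refine ⟨Int.natAbs_pos.mpr h, ?_⟩
      rcases Int.natAbs_eq (((P : Matrix ι ι ℤ) * M * (Q : Matrix κ κ ℤ)) i j) with h' | h'
      · exact ⟨P, Q, i, j, h'⟩
      · refine ⟨-P, Q, i, j, ?_⟩
        rw [Units.val_neg, Matrix.neg_mul, Matrix.neg_mul, Matrix.neg_apply]
        omega
    have hS : S.Nonempty := by
      have : ∃ i j, M i j ≠ 0 := by
        by_contra! h
        exact hM (by ext i j; simpa using h i j)
      obtain ⟨i, j, hij⟩ := this
      exact ⟨_, habs 1 1 i j (by simpa using hij)⟩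
    obtain ⟨hg, P, Q, i, j, hij⟩ := Nat.sInf_mem hS
    set g := sInf S with hgdef
    set M' := (P : Matrix ι ι ℤ) * M * (Q : Matrix κ κ ℤ) with hM'
    have hdvd := pivot_dvd (M := M') hij hg (by
      intro P' Q' i' j' h
      have e : (P' : Matrix ι ι ℤ) * M' * (Q' : Matrix κ κ ℤ) =
          ((P' * P : (Matrix ι ι ℤ)ˣ) : Matrix ι ι ℤ) * M *
          ((Q * Q' : (Matrix κ κ ℤ)ˣ) : Matrix κ κ ℤ) := by
        simp [hM', Matrix.mul_assoc]
      rw [e] at h ⊢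
      exact Nat.sInf_le (habs _ _ _ _ h))
    choose W hW using hdvd
    let σ : Unit ⊕ {x // x ≠ i} ≃ ι := (Equiv.sumComm _ _).trans
      ((Equiv.optionEquivSumPUnit _).symm.trans (Equiv.optionSubtypeNe i))
    let τ : Unit ⊕ {x // x ≠ j} ≃ κ := (Equiv.sumComm _ _).trans
      ((Equiv.optionEquivSumPUnit _).symm.trans (Equiv.optionSubtypeNe j))
    have hσ : σ (Sum.inl ()) = i := by simp [σ]
    have hτ : τ (Sum.inl ()) = j := by simp [τ]
    have hWij : W i j = 1 := by
      have := hW i j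
      rw [hij] at this
      have hg' : (g : ℤ) ≠ 0 := by omega
      exact (mul_left_cancel₀ hg' (by rw [mul_one]; exact this)).symm
    let u : Matrix {x // x ≠ i} Unit ℤ := Matrix.of fun x _ => W x j
    let v : Matrix Unit {x // x ≠ j} ℤ := Matrix.of fun _ y => W i y
    -- With `M' = g W` and `W i j = 1`, this is the Schur complement of the pivot in `W`. It has one
    -- row less, and all its invariant factors get multiplied by `g`, which preserves divisibility.
    let M'' : Matrix {x // x ≠ i} {x // x ≠ j} ℤ :=
      Matrix.of fun x y => W x y - W x j * W i y
    obtain ⟨r, d, hrd⟩ := ih M'' (by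
      rw [Fintype.card_subtype_compl, hN]; simp)
    refine ⟨_, _, HasSmithForm.of_mul P Q (HasSmithForm.of_submatrix σ τ
      (HasSmithForm.of_mul
        ⟨Matrix.fromBlocks 1 0 (-u) 1, Matrix.fromBlocks 1 0 u 1, ?_, ?_⟩
        ⟨Matrix.fromBlocks 1 (-v) 0 1, Matrix.fromBlocks 1 v 0 1, ?_, ?_⟩
        (Eq.mp (congrArg (fun X => HasSmithForm X _ _) ?_) (hrd.fromBlocks hg))))⟩
    · simp [Matrix.fromBlocks_multiply]
    · simp [Matrix.fromBlocks_multiply]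
    · simp [Matrix.fromBlocks_multiply]
    · simp [Matrix.fromBlocks_multiply]
    · have hsub : M'.submatrix σ τ = Matrix.fromBlocks (Matrix.of fun _ _ : Unit => (g : ℤ))
          ((g : ℤ) • v) ((g : ℤ) • u) ((g : ℤ) • 
          (Matrix.of fun (x : {x // x ≠ i}) (y : {y // y ≠ j}) => W x y)) := by
        ext (x | x) (y | y)
        · simp [hσ, hτ, hij]
        · simp [hσ, v, hW, τ]
        · simp [hτ, u, hW, σ]
        · simp [hW, σ, τ]
      show _ = Matrix.fromBlocks 1 0 (-u) 1 * (M'.submatrix σ τ) * Matrix.fromBlocks 1 (-v) 0 1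
      rw [hsub]
      simp only [Matrix.fromBlocks_multiply]
      ext (x | x) (y | y)
      · simp
      · simp [Matrix.mul_apply, v]
      · simp [Matrix.mul_apply, u, mul_comm]
      · simp [Matrix.mul_apply, u, v, M'']
        ring

/-! ### Rank and invariant factors. -/

section Rank

variable {ι κ : Type} [Fintype ι] [DecidableEq ι] [Fintype κ] [DecidableEq κ]

/-- The matrix factors through the diagonal matrix `Δ`, and `Δ` is recovered from it by
multiplication with the transposed selection matrices, so neither rank exceeds the other. -/
theorem rank_sum_single {K : Type} [Field K] {r : ℕ} (e : Fin r ↪ ι) (f : Fin r ↪ κ) (d : ℕ → K)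
    (hd : ∀ k, k < r → d k ≠ 0) :
    (∑ k : Fin r, Matrix.single (e k) (f k) (d k)).rank = r := by
  classical
  set D := ∑ k : Fin r, Matrix.single (e k) (f k) (d k) with hD
  let E : Matrix ι (Fin r) K := Matrix.of fun i k => if e k = i then 1 else 0
  let F : Matrix (Fin r) κ K := Matrix.of fun k j => if f k = j then 1 else 0
  let Δ : Matrix (Fin r) (Fin r) K := Matrix.diagonal (fun k => d k)
  have h1 : D = E * Δ * F := by
    ext i j
    rw [hD, Matrix.sum_apply, Matrix.mul_apply]
    refine Finset.sum_congr rfl fun k _ => ?_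
    rw [Matrix.mul_diagonal]
    simp [E, F, Matrix.single_apply]
    split_ifs <;> simp_all
  have h2 : Δ = Eᵀ * D * Fᵀ := by
    have hE : Eᵀ * E = 1 := by
      ext k k'
      simp [E, Matrix.mul_apply, Matrix.one_apply, e.injective.eq_iff, eq_comm]
    have hF : F * Fᵀ = 1 := by
      ext k k'
      simp [F, Matrix.mul_apply, Matrix.one_apply, f.injective.eq_iff, eq_comm]
    rw [h1]
    calc Δ = (Eᵀ * E) * Δ * (F * Fᵀ) := by rw [hE, hF]; simp
      _ = _ := by simp only [Matrix.mul_assoc]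
  have h3 : Δ.rank = r := by
    rw [Matrix.rank_of_det_ne_zero, Fintype.card_fin]
    rw [Matrix.det_diagonal]
    exact Finset.prod_ne_zero_iff.mpr fun k _ => hd k k.2
  apply le_antisymm
  · rw [h1]
    exact (Matrix.rank_mul_le_right _ _).trans ((Matrix.rank_le_card_height _).trans (by simp))
  · rw [← h3, h2]
    exact (Matrix.rank_mul_le_left _ _).trans (Matrix.rank_mul_le_right _ _)

/-- The rank of an integral matrix over a field of characteristic zero can be read off from its
Smith normal form. -/
theorem HasSmithForm.rank_map {M : Matrix ι κ ℤ} {r : ℕ} {d : ℕ → ℕ} (h : HasSmithForm M r d)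
    (K : Type) [Field K] [CharZero K] : (M.map (Int.cast : ℤ → K)).rank = r := by
  obtain ⟨h1, -, -, P, Q, e, f, h4⟩ := h
  have h5 := congrArg (fun X : Matrix ι κ ℤ => X.map (Int.castRingHom K)) h4
  simp only [Matrix.map_mul] at h5
  have hP : IsUnit ((P : Matrix ι ι ℤ).map (Int.castRingHom K)) :=
    (P.isUnit.map (Int.castRingHom K).mapMatrix)
  have hQ : IsUnit ((Q : Matrix κ κ ℤ).map (Int.castRingHom K)) :=
    (Q.isUnit.map (Int.castRingHom K).mapMatrix)
  have h6 := congrArg Matrix.rank h5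
  rw [Matrix.rank_mul_eq_left_of_isUnit_det _ _ ((Matrix.isUnit_iff_isUnit_det _).mp hQ),
    Matrix.rank_mul_eq_right_of_isUnit_det _ _ ((Matrix.isUnit_iff_isUnit_det _).mp hP)] at h6
  refine h6.trans (Eq.trans ?_ (rank_sum_single (K := K) e f (fun k => (d k : K))
    (fun k hk => Nat.cast_ne_zero.mpr (h1 k hk).ne')))
  congr 1
  ext i j
  simp [Matrix.sum_apply, Matrix.single_apply]

/-- The number of diagonal entries in any Smith form is forced to be the rank, so the choice in
`invFactor` is not vacuous. Only this property is used later; uniqueness of the invariant factors is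
not needed. -/
theorem hasSmithForm_invFactor (M : Matrix ι κ ℤ) :
    HasSmithForm M (intRank M) (invFactor M) := by
  obtain ⟨r, d, h⟩ := exists_hasSmithForm _ M rfl
  have hr : intRank M = r := h.rank_map ℚ
  subst hr
  have hex : ∃ d, IsInvariantFactors M d := ⟨d, h⟩
  rw [invFactor, dif_pos hex]
  exact hex.choose_spec

theorem rank_map_eq_intRank (M : Matrix ι κ ℤ) (K : Type) [Field K] [CharZero K] :
    (M.map (Int.cast : ℤ → K)).rank = intRank M :=
  (hasSmithForm_invFactor M).rank_map K

end Rank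

/-! ### Greatest common divisors of divisibility chains, and diagonal systems. -/

/-- Two divisibility chains whose products of greatest common divisors with every divisor of `q`
agree have the same greatest common divisors with `q`. -/
theorem gcd_eq_of_prod_gcd_eq {d d' : ℕ → ℕ} (hd : ∀ k, d k ∣ d (k + 1))
    (hd' : ∀ k, d' k ∣ d' (k + 1)) {q : ℕ} (hq : 0 < q) (N : ℕ)
    (h : ∀ q', q' ∣ q → ∏ j ∈ Finset.range N, (d j).gcd q' = ∏ j ∈ Finset.range N, (d' j).gcd q') :
    ∀ j < N, (d j).gcd q = (d' j).gcd q := by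
  -- Test the hypothesis at `q' = gcd(d N, q)`. Since `d j ∣ d N`, the left product is the same as
  -- for `q`, hence so is the right one. As its factors can only shrink, none does, and `gcd(d' N,
  -- q)` divides `gcd(d N, q)`.
  have top : ∀ (N : ℕ) (d d' : ℕ → ℕ), (∀ k, d k ∣ d (k + 1)) →
      (∀ q', q' ∣ q → ∏ j ∈ Finset.range (N + 1), (d j).gcd q' =
        ∏ j ∈ Finset.range (N + 1), (d' j).gcd q') → (d' N).gcd q ∣ (d N).gcd q := by
    intro N d d' hd h
    have h1 := h _ (Nat.gcd_dvd_right (d N) q)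
    have h2 := h q dvd_rfl
    have h3 : ∏ j ∈ Finset.range (N + 1), (d j).gcd ((d N).gcd q) =
        ∏ j ∈ Finset.range (N + 1), (d j).gcd q := by
      refine Finset.prod_congr rfl fun j hj => ?_
      have hjN : d j ∣ d N := by
        have hm : ∀ t, d j ∣ d (j + t) := by
          intro t
          induction t with
          | zero => exact dvd_rfl
          | succ t ih => exact ih.trans (hd _)
        have := hm (N - j)
        rwa [Nat.add_sub_cancel' (Nat.lt_succ_iff.mp (Finset.mem_range.mp hj))] at this
      rw [← Nat.gcd_assoc, Nat.gcd_eq_left hjN]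
    rw [h3, h2] at h1
    have h4 : ∀ j, (d' j).gcd ((d N).gcd q) ≤ (d' j).gcd q := fun j =>
      Nat.le_of_dvd (Nat.gcd_pos_of_pos_right _ hq)
        (Nat.gcd_dvd_gcd_of_dvd_right _ (Nat.gcd_dvd_right _ _))
    have h5 : (d' N).gcd ((d N).gcd q) = (d' N).gcd q := by
      by_contra hne
      have hlt := lt_of_le_of_ne (h4 N) hne
      have := Finset.prod_lt_prod (s := Finset.range (N + 1))
        (f := fun j => (d' j).gcd ((d N).gcd q)) (g := fun j => (d' j).gcd q)
        (fun j _ => Nat.gcd_pos_of_pos_right _ (Nat.gcd_pos_of_pos_right _ hq))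
        (fun j _ => h4 j) ⟨N, by simp, hlt⟩
      exact absurd h1 this.ne'
    rw [← h5]
    exact Nat.gcd_dvd_right _ _
  induction N with
  | zero => simp
  | succ N ih =>
    have hN : (d N).gcd q = (d' N).gcd q :=
      Nat.dvd_antisymm (top N d' d hd' fun q' hq' => (h q' hq').symm) (top N d d' hd h)
    -- The top factors also agree for every divisor of `q` and can be cancelled, which leaves the
    -- shorter chains.
    have h' : ∀ q', q' ∣ q →
        ∏ j ∈ Finset.range N, (d j).gcd q' = ∏ j ∈ Finset.range N, (d' j).gcd q' := by
      intro q' hq'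
      have h1 := h q' hq'
      rw [Finset.prod_range_succ, Finset.prod_range_succ] at h1
      have h2 : (d N).gcd q' = (d' N).gcd q' := by
        rw [← Nat.gcd_eq_right hq', ← Nat.gcd_assoc, hN, Nat.gcd_assoc]
      rw [h2] at h1
      exact Nat.eq_of_mul_eq_mul_right
        (Nat.gcd_pos_of_pos_right _ (Nat.pos_of_dvd_of_pos hq' hq)) h1
    intro j hj
    rcases Nat.lt_succ_iff_lt_or_eq.mp hj with hj | rfl
    · exact ih h' j hj
    · exact hN

theorem card_annihilated_zmod (q : ℕ) [NeZero q] (d : ℕ) :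
    Nat.card {y : ZMod q // (d : ZMod q) * y = 0} = d.gcd q := by
  have h := IsAddCyclic.card_nsmulAddMonoidHom_ker (G := ZMod q) d
  rw [Nat.card_zmod, Nat.gcd_comm] at h
  rw [← h]
  refine Nat.card_congr (Equiv.subtypeEquivRight fun y => ?_)
  rw [AddMonoidHom.mem_ker]
  simp

theorem sum_single_mulVec {R ι κ : Type} [CommRing R] [DecidableEq ι] [Fintype κ]
    [DecidableEq κ] {r : ℕ} (e : Fin r ↪ ι) (f : Fin r ↪ κ) (d : Fin r → R) (y : κ → R) (i : ι) :
    ((∑ k : Fin r, Matrix.single (e k) (f k) (d k)) *ᵥ y) i =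
      ∑ k : Fin r, if e k = i then d k * y (f k) else 0 := by
  simp only [Matrix.mulVec, dotProduct, Matrix.sum_apply, Matrix.single_apply, Finset.sum_mul]
  rw [Finset.sum_comm]
  refine Finset.sum_congr rfl fun k _ => ?_
  by_cases h : e k = i <;> simp [h]

theorem sum_single_mulVec_apply {R ι κ : Type} [CommRing R] [DecidableEq ι] [Fintype κ]
    [DecidableEq κ] {r : ℕ} (e : Fin r ↪ ι) (f : Fin r ↪ κ) (d : Fin r → R) (y : κ → R)
    (k : Fin r) :
    ((∑ k : Fin r, Matrix.single (e k) (f k) (d k)) *ᵥ y) (e k) = d k * y (f k) := by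
  rw [sum_single_mulVec]
  simp [e.injective.eq_iff]

theorem sum_single_mulVec_eq_zero {R ι κ : Type} [CommRing R] [DecidableEq ι] [Fintype κ]
    [DecidableEq κ] {r : ℕ} (e : Fin r ↪ ι) (f : Fin r ↪ κ) (d : Fin r → R) (y : κ → R) :
    (∑ k : Fin r, Matrix.single (e k) (f k) (d k)) *ᵥ y = 0 ↔ ∀ k, d k * y (f k) = 0 := by
  constructor
  · intro h k
    rw [← sum_single_mulVec_apply e f d y k, h, Pi.zero_apply]
  · intro h
    ext i
    rw [sum_single_mulVec]
    exact Finset.sum_eq_zero fun k _ => by simp [h]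

theorem matMod_mul {ι κ μ : Type} [Fintype κ] (q : ℕ) (M : Matrix ι κ ℤ) (N : Matrix κ μ ℤ) :
    matMod q (M * N) = matMod q M * matMod q N :=
  Matrix.map_mul (f := Int.castRingHom (ZMod q))

theorem matMod_mulVec {ι κ : Type} [Fintype κ] (q : ℕ) (M : Matrix ι κ ℤ) (x : κ → ℤ) :
    matMod q M *ᵥ vecMod q x = vecMod q (M *ᵥ x) := by
  ext i
  exact ((Int.castRingHom (ZMod q)).map_mulVec M x i).symm

theorem matMod_one {κ : Type} [DecidableEq κ] (q : ℕ) :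
    matMod q (1 : Matrix κ κ ℤ) = 1 :=
  Matrix.map_one _ Int.cast_zero Int.cast_one

/-! ### Column modules and solvability modulo `q`. -/

section ColumnSpace

variable {ι κ : Type} [Fintype κ]

/-- The number of solutions of the homogeneous system with matrix `M` modulo `q`. -/
noncomputable def kerCount (q : ℕ) (M : Matrix ι κ ℤ) : ℕ :=
  Nat.card {x : κ → ZMod q // matMod q M *ᵥ x = 0}

theorem colSpaceMod_eq_range (q : ℕ) (M : Matrix ι κ ℤ) :
    colSpaceMod q M = LinearMap.range (matMod q M).mulVecLin := by
  rw [colSpaceMod, Matrix.range_mulVecLin]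

theorem fromCols_mulVec_replicateCol {R : Type} [CommRing R] (M : Matrix ι κ R) (c : ι → R)
    (x : κ ⊕ Unit → R) :
    Matrix.fromCols M (Matrix.replicateCol Unit c) *ᵥ x =
      M *ᵥ (x ∘ Sum.inl) + x (Sum.inr ()) • c := by
  rw [← Sum.elim_comp_inl_inr x, Matrix.fromCols_mulVec_sumElim]
  congr 1
  ext i
  simp [Matrix.mulVec, dotProduct, mul_comm]

theorem matMod_fromCols {ι κ : Type} (q : ℕ) (M : Matrix ι κ ℤ) (c : ι → ℤ) :
    matMod q (Matrix.fromCols M (Matrix.replicateCol Unit c)) =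
      Matrix.fromCols (matMod q M) (Matrix.replicateCol Unit (vecMod q c)) := by
  ext i (j | j) <;> rfl

theorem card_colSpaceMod_mul_kerCount (q : ℕ) [NeZero q] (M : Matrix ι κ ℤ) :
    Nat.card (colSpaceMod q M) * kerCount q M = q ^ Fintype.card κ := by
  have h := Submodule.card_eq_card_quotient_mul_card (LinearMap.ker (matMod q M).mulVecLin)
  rw [Nat.card_congr ((matMod q M).mulVecLin.quotKerEquivRange).toEquiv] at h
  rw [colSpaceMod_eq_range]
  have h2 : kerCount q M = Nat.card (LinearMap.ker (matMod q M).mulVecLin) :=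
    Nat.card_congr (Equiv.subtypeEquivRight fun x => by simp)
  rw [h2, mul_comm, ← h, Nat.card_fun, Nat.card_zmod, Nat.card_eq_fintype_card]

theorem mem_colSpaceMod_iff_exists (q : ℕ) (M : Matrix ι κ ℤ) (c : ι → ZMod q) :
    c ∈ colSpaceMod q M ↔ ∃ x, matMod q M *ᵥ x = c := by
  rw [colSpaceMod_eq_range]
  simp [LinearMap.mem_range]

/-- Lifting the congruence to an integral equation makes solvability for different moduli
comparable. -/
theorem mem_colSpaceMod_iff (q : ℕ) (M : Matrix ι κ ℤ) (c : ι → ℤ) :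
    vecMod q c ∈ colSpaceMod q M ↔ ∃ (x : κ → ℤ) (z : ι → ℤ), M *ᵥ x + (q : ℤ) • z = c := by
  rw [mem_colSpaceMod_iff_exists]
  constructor
  · rintro ⟨x, hx⟩
    obtain ⟨y, rfl⟩ : ∃ y : κ → ℤ, vecMod q y = x :=
      ⟨fun j => (ZMod.intCast_surjective (x j)).choose,
        funext fun j => (ZMod.intCast_surjective (x j)).choose_spec⟩
    rw [matMod_mulVec] at hx
    have : ∀ i, ∃ z : ℤ, c i - (M *ᵥ y) i = q * z := by
      intro i
      have := congrFun hx i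
      simp only [vecMod] at this
      exact (ZMod.intCast_eq_intCast_iff_dvd_sub _ _ _).mp this
    choose z hz using this
    refine ⟨y, z, funext fun i => ?_⟩
    simp only [Pi.add_apply, Pi.smul_apply, smul_eq_mul]
    rw [← hz i]; ring
  · rintro ⟨x, z, rfl⟩
    refine ⟨vecMod q x, ?_⟩
    rw [matMod_mulVec]
    ext i
    simp [vecMod]

theorem card_solutions (q : ℕ) (M : Matrix ι κ ℤ) (c : ι → ZMod q) (hc : c ∈ colSpaceMod q M) :
    Nat.card {x : κ → ZMod q // matMod q M *ᵥ x = c} = kerCount q M := by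
  obtain ⟨x₀, hx₀⟩ := (mem_colSpaceMod_iff_exists q M c).mp hc
  refine (Nat.card_congr (Equiv.subtypeEquiv (Equiv.addRight x₀) fun x => ?_)).symm
  rw [Equiv.coe_addRight, Matrix.mulVec_add, hx₀]
  simp

theorem mem_colSpaceMod_of_dvd {q q' : ℕ} (hq : q' ∣ q) {M : Matrix ι κ ℤ} {c : ι → ℤ}
    (h : vecMod q c ∈ colSpaceMod q M) : vecMod q' c ∈ colSpaceMod q' M := by
  rw [mem_colSpaceMod_iff] at h ⊢
  obtain ⟨x, z, h⟩ := h
  obtain ⟨t, rfl⟩ := hq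
  exact ⟨x, (t : ℤ) • z, by rw [← h, smul_smul]; push_cast; rfl⟩

theorem colSpaceMod_le_fromCols (q : ℕ) (M : Matrix ι κ ℤ) (c : ι → ℤ) :
    colSpaceMod q M ≤ colSpaceMod q (Matrix.fromCols M (Matrix.replicateCol Unit c)) := by
  intro v hv
  rw [mem_colSpaceMod_iff_exists] at hv ⊢
  obtain ⟨x, rfl⟩ := hv
  refine ⟨Sum.elim x 0, ?_⟩
  rw [matMod_fromCols, fromCols_mulVec_replicateCol]
  simp

theorem mem_colSpaceMod_iff_eq (q : ℕ) (M : Matrix ι κ ℤ) (c : ι → ℤ) :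
    vecMod q c ∈ colSpaceMod q M ↔
      colSpaceMod q M = colSpaceMod q (Matrix.fromCols M (Matrix.replicateCol Unit c)) := by
  constructor
  · intro h
    refine le_antisymm (colSpaceMod_le_fromCols q M c) fun v hv => ?_
    rw [mem_colSpaceMod_iff_exists] at hv
    obtain ⟨x, rfl⟩ := hv
    rw [matMod_fromCols, fromCols_mulVec_replicateCol]
    exact add_mem ((mem_colSpaceMod_iff_exists _ _ _).mpr ⟨_, rfl⟩) (Submodule.smul_mem _ _ h)
  · intro h
    rw [h, mem_colSpaceMod_iff_exists]
    refine ⟨Sum.elim 0 1, ?_⟩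
    rw [matMod_fromCols, fromCols_mulVec_replicateCol]
    simp

theorem range_le_range_fromCols {ι κ K : Type} [Fintype κ] [Field K] (M : Matrix ι κ K)
    (c : ι → K) : LinearMap.range M.mulVecLin ≤
      LinearMap.range (Matrix.fromCols M (Matrix.replicateCol Unit c)).mulVecLin := by
  rintro _ ⟨x, rfl⟩
  refine ⟨Sum.elim x 0, ?_⟩
  rw [Matrix.mulVecLin_apply, fromCols_mulVec_replicateCol]
  simp

theorem map_fromCols_replicateCol {ι κ K : Type} [Field K] (M : Matrix ι κ ℤ) (c : ι → ℤ) :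
    (Matrix.fromCols M (Matrix.replicateCol Unit c)).map (Int.cast : ℤ → K) =
      Matrix.fromCols (M.map (Int.cast : ℤ → K))
        (Matrix.replicateCol Unit (fun i => (c i : K))) := by
  ext i (j | j) <;> rfl

/-- Equal ranks put `c` in the rational column space; clearing the denominators of a rational
solution gives `m` and `x`. -/
theorem exists_mulVec_eq_smul_of_rank {M : Matrix ι κ ℤ} {c : ι → ℤ}
    (h : intRank (Matrix.fromCols M (Matrix.replicateCol Unit c)) = intRank M) :
    ∃ (m : ℤ) (x : κ → ℤ), m ≠ 0 ∧ M *ᵥ x = m • c := by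
  have hle := range_le_range_fromCols (M.map (Int.cast : ℤ → ℚ)) (fun i => (c i : ℚ))
  rw [intRank, intRank, map_fromCols_replicateCol] at h
  have heq := Submodule.eq_of_le_of_finrank_eq hle h.symm
  have hc : (fun i => (c i : ℚ)) ∈ LinearMap.range (M.map (Int.cast : ℤ → ℚ)).mulVecLin := by
    rw [heq]
    refine ⟨Sum.elim 0 1, ?_⟩
    rw [Matrix.mulVecLin_apply, fromCols_mulVec_replicateCol]
    simp
  obtain ⟨x, hx⟩ := hc
  obtain ⟨⟨m, hm⟩, hb⟩ := IsLocalization.exist_integer_multiples_of_finite (nonZeroDivisors ℤ) x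
  choose y hy using hb
  refine ⟨m, y, nonZeroDivisors.ne_zero hm, ?_⟩
  ext i
  have h1 := congrFun hx i
  simp only [Matrix.mulVecLin_apply, Matrix.mulVec, dotProduct, Matrix.map_apply] at h1
  simp only [Matrix.mulVec, dotProduct, Pi.smul_apply, smul_eq_mul]
  have h2 : (((∑ j, M i j * y j : ℤ)) : ℚ) = ((m * c i : ℤ) : ℚ) := by
    push_cast
    rw [← h1, Finset.mul_sum]
    refine Finset.sum_congr rfl fun j _ => ?_
    have := hy j
    simp only [algebraMap_int_eq, eq_intCast, zsmul_eq_mul] at this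
    rw [this]
    ring
  exact_mod_cast h2

end ColumnSpace

/-! ### Counting solutions with the Smith normal form. -/

section Counting

variable {ι κ : Type} [Fintype ι] [DecidableEq ι] [Fintype κ] [DecidableEq κ]

theorem exists_equiv_extending {r : ℕ} (f : Fin r ↪ κ) :
    ∃ φ : Fin (Fintype.card κ) ≃ κ, ∀ (k : Fin r) (hk : (k : ℕ) < Fintype.card κ),
      φ ⟨k, hk⟩ = f k := by
  classical
  -- Only the values below `r` are prescribed for the extension; the others are fillers.
  let F : Fin (Fintype.card κ) → κ := fun i =>
    if h : (i : ℕ) < r then f ⟨i, h⟩ else (Fintype.equivFin κ).symm i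
  obtain ⟨g, hg⟩ := Finset.exists_equiv_extend_of_card_eq (α := Fin (Fintype.card κ))
    (t := (Finset.univ : Finset κ)) (by simp)
    (s := Finset.univ.filter fun i => (i : ℕ) < r) (f := F) (Finset.subset_univ _) (by
      intro a ha b hb hab
      simp only [Finset.coe_filter, Finset.mem_univ, true_and, Set.mem_ofPred_eq] at ha hb
      simp only [F, dif_pos ha, dif_pos hb] at hab
      have := f.injective hab
      simp only [Fin.mk.injEq] at this
      exact Fin.ext this)
  refine ⟨g.trans (Equiv.subtypeUnivEquiv (by simp)), fun k hk => ?_⟩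
  have := hg ⟨k, hk⟩ (by simp)
  simpa [F] using this

/-- The substitution `x = Q y` decouples the system into `d j * y j = 0`. Columns without a pivot
have `d j = 0` and give the factor `gcd(0, q) = q`, so the product can run over all columns. -/
theorem HasSmithForm.kerCount_eq {M : Matrix ι κ ℤ} {r : ℕ} {d : ℕ → ℕ} (h : HasSmithForm M r d)
    (q : ℕ) [NeZero q] :
    kerCount q M = ∏ j ∈ Finset.range (Fintype.card κ), (d j).gcd q := by
  obtain ⟨h1, h2, h3, P, Q, e, f, h4⟩ := h
  have hr : r ≤ Fintype.card κ := by simpa using Fintype.card_le_of_embedding f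
  obtain ⟨φ, hφ⟩ := exists_equiv_extending f
  have h5 : matMod q (P : Matrix ι ι ℤ) * matMod q M * matMod q (Q : Matrix κ κ ℤ) =
      ∑ k : Fin r, Matrix.single (e k) (f k) ((d k : ℕ) : ZMod q) := by
    rw [← matMod_mul, ← matMod_mul, h4]
    ext i j
    simp only [matMod, Matrix.map_apply, Matrix.sum_apply, Matrix.single_apply, Int.cast_sum]
    refine Finset.sum_congr rfl fun k _ => ?_
    split_ifs <;> simp
  have hP : matMod q ((P⁻¹ : (Matrix ι ι ℤ)ˣ) : Matrix ι ι ℤ) * matMod q (P : Matrix ι ι ℤ) = 1 := by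
    rw [← matMod_mul, Units.inv_mul, matMod_one]
  have hQ : matMod q (Q : Matrix κ κ ℤ) * matMod q ((Q⁻¹ : (Matrix κ κ ℤ)ˣ) : Matrix κ κ ℤ) = 1 := by
    rw [← matMod_mul, Units.mul_inv, matMod_one]
  have hQ' : matMod q ((Q⁻¹ : (Matrix κ κ ℤ)ˣ) : Matrix κ κ ℤ) * matMod q (Q : Matrix κ κ ℤ) = 1 := by
    rw [← matMod_mul, Units.inv_mul, matMod_one]
  let E : (κ → ZMod q) ≃ (κ → ZMod q) :=
    { toFun := fun y => matMod q (Q : Matrix κ κ ℤ) *ᵥ y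
      invFun := fun x => matMod q ((Q⁻¹ : (Matrix κ κ ℤ)ˣ) : Matrix κ κ ℤ) *ᵥ x
      left_inv := fun y => by
        simp only [Matrix.mulVec_mulVec, hQ', Matrix.one_mulVec]
      right_inv := fun y => by
        simp only [Matrix.mulVec_mulVec, hQ, Matrix.one_mulVec] }
  have hE : ∀ y, matMod q M *ᵥ (E y) = 0 ↔ ∀ j : Fin (Fintype.card κ),
      ((d j : ℕ) : ZMod q) * y (φ j) = 0 := by
    intro y
    have e1 : matMod q M *ᵥ (E y) = 0 ↔
        (∑ k : Fin r, Matrix.single (e k) (f k) ((d k : ℕ) : ZMod q)) *ᵥ y = 0 := by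
      rw [← h5, ← Matrix.mulVec_mulVec, ← Matrix.mulVec_mulVec]
      constructor
      · intro hh
        change matMod q (P : Matrix ι ι ℤ) *ᵥ (matMod q M *ᵥ (E y)) = 0
        rw [hh, Matrix.mulVec_zero]
      · intro hh
        have := congrArg (fun v => matMod q ((P⁻¹ : (Matrix ι ι ℤ)ˣ) : Matrix ι ι ℤ) *ᵥ v) hh
        simp only [Matrix.mulVec_mulVec, ← Matrix.mul_assoc, hP, Matrix.one_mul,
          Matrix.mulVec_zero] at this
        simpa [E, Matrix.mulVec_mulVec] using this
    rw [e1, sum_single_mulVec_eq_zero]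
    constructor
    · intro hh j
      by_cases hj : (j : ℕ) < r
      · have := hh ⟨j, hj⟩
        rwa [← hφ ⟨j, hj⟩ j.2] at this
      · rw [h2 j (by omega)]; simp
    · intro hh k
      have := hh ⟨k, k.2.trans_le hr⟩
      rwa [hφ k] at this
  have e2 : kerCount q M =
      Nat.card {y : Fin (Fintype.card κ) → ZMod q //
        ∀ j : Fin (Fintype.card κ), ((d j : ℕ) : ZMod q) * y j = 0} := by
    refine Nat.card_congr (Equiv.symm ?_)
    refine Equiv.subtypeEquiv (((Equiv.arrowCongr φ (Equiv.refl _))).trans E) fun y => ?_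
    rw [Equiv.trans_apply, hE]
    simp
  rw [e2, Nat.card_congr (Equiv.subtypePiEquivPi
    (p := fun (j : Fin (Fintype.card κ)) (y : ZMod q) => ((d j : ℕ) : ZMod q) * y = 0)),
    Nat.card_pi, Finset.prod_range]
  exact Finset.prod_congr rfl fun j _ => card_annihilated_zmod q _

/-- Solvability of a linear system modulo `q` in terms of the invariant factors. -/
theorem mem_colSpaceMod_iff_prod {M : Matrix ι κ ℤ} {c : ι → ℤ} {r r' : ℕ} {d d' : ℕ → ℕ}
    (h : HasSmithForm M r d)
    (h' : HasSmithForm (Matrix.fromCols M (Matrix.replicateCol Unit c)) r' d')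
    (q : ℕ) [NeZero q] :
    vecMod q c ∈ colSpaceMod q M ↔
      ∏ j ∈ Finset.range (Fintype.card κ + 1), (d j).gcd q =
        ∏ j ∈ Finset.range (Fintype.card κ + 1), (d' j).gcd q := by
  have hq : 0 < q := NeZero.pos q
  have hr : r ≤ Fintype.card κ := by
    obtain ⟨-, -, -, -, -, -, f, -⟩ := h
    simpa using Fintype.card_le_of_embedding f
  have e1 := card_colSpaceMod_mul_kerCount q M
  have e2 := card_colSpaceMod_mul_kerCount q (Matrix.fromCols M (Matrix.replicateCol Unit c))
  rw [h.kerCount_eq] at e1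
  rw [h'.kerCount_eq, Fintype.card_sum, Fintype.card_unit, pow_succ] at e2
  -- The factor with index `card κ` is `gcd(0, q) = q`. It makes up for the extra column of the
  -- augmented matrix, so that both column modules satisfy the same counting identity `e4`.
  have e3 : ∏ j ∈ Finset.range (Fintype.card κ + 1), (d j).gcd q =
      (∏ j ∈ Finset.range (Fintype.card κ), (d j).gcd q) * q := by
    rw [Finset.prod_range_succ, h.2.1 _ hr, Nat.gcd_zero_left]
  have e4 : Nat.card (colSpaceMod q M) *
      ∏ j ∈ Finset.range (Fintype.card κ + 1), (d j).gcd q =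
      Nat.card (colSpaceMod q (Matrix.fromCols M (Matrix.replicateCol Unit c))) *
      ∏ j ∈ Finset.range (Fintype.card κ + 1), (d' j).gcd q := by
    rw [e2, e3, ← e1, mul_assoc]
  have hpos : ∀ d : ℕ → ℕ, 0 < ∏ j ∈ Finset.range (Fintype.card κ + 1), (d j).gcd q :=
    fun d => Finset.prod_pos fun j _ => Nat.gcd_pos_of_pos_right _ hq
  rw [mem_colSpaceMod_iff_eq]
  constructor
  · intro heq
    rw [← heq] at e4
    exact Nat.eq_of_mul_eq_mul_left Nat.card_pos e4
  · intro heq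
    rw [heq] at e4
    have hcard := Nat.eq_of_mul_eq_mul_right (hpos d') e4
    have hle := colSpaceMod_le_fromCols q M c
    refine SetLike.coe_injective (Set.eq_of_subset_of_ncard_le hle ?_ (Set.toFinite _))
    exact hcard.ge

/-- Solvability modulo `q` implies solvability modulo every divisor of `q`. The product criterion
therefore holds at all divisors, and `gcd_eq_of_prod_gcd_eq` separates the factors. From `r'` on
both chains vanish, because `r ≤ r'`. -/
theorem mem_colSpaceMod_iff_gcd {M : Matrix ι κ ℤ} {c : ι → ℤ} {r r' : ℕ} {d d' : ℕ → ℕ}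
    (h : HasSmithForm M r d)
    (h' : HasSmithForm (Matrix.fromCols M (Matrix.replicateCol Unit c)) r' d') (hr : r ≤ r')
    (q : ℕ) [NeZero q] :
    vecMod q c ∈ colSpaceMod q M ↔ ∀ j < r', q.gcd (d j) = q.gcd (d' j) := by
  have hr' : r' ≤ Fintype.card κ + 1 := by
    obtain ⟨-, -, -, -, -, -, f, -⟩ := h'
    simpa using Fintype.card_le_of_embedding f
  have hq : 0 < q := NeZero.pos q
  constructor
  · intro hc j hj
    rw [Nat.gcd_comm, Nat.gcd_comm q]
    refine gcd_eq_of_prod_gcd_eq h.2.2.1 h'.2.2.1 hq (Fintype.card κ + 1) ?_ j (hj.trans_le hr')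
    intro q' hq'
    have : NeZero q' := ⟨(Nat.pos_of_dvd_of_pos hq' hq).ne'⟩
    exact (mem_colSpaceMod_iff_prod h h' q').mp (mem_colSpaceMod_of_dvd hq' hc)
  · intro hc
    rw [mem_colSpaceMod_iff_prod h h' q]
    refine Finset.prod_congr rfl fun j _ => ?_
    by_cases hj : j < r'
    · rw [Nat.gcd_comm, Nat.gcd_comm _ q]
      exact hc j hj
    · rw [h.2.1 j (by omega), h'.2.1 j (by omega)]

theorem HasSmithForm.kerCount_eq_mul_pow {M : Matrix ι κ ℤ} {r : ℕ} {d : ℕ → ℕ}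
    (h : HasSmithForm M r d) (q : ℕ) [NeZero q] :
    kerCount q M = (∏ j ∈ Finset.range r, (d j).gcd q) * q ^ (Fintype.card κ - r) := by
  have hr : r ≤ Fintype.card κ := by
    obtain ⟨-, -, -, -, -, -, f, -⟩ := h
    simpa using Fintype.card_le_of_embedding f
  rw [h.kerCount_eq, ← Finset.prod_range_mul_prod_Ico _ hr]
  congr 1
  rw [Finset.prod_congr rfl (g := fun _ => q)]
  · simp
  · intro j hj
    rw [h.2.1 j (Finset.mem_Ico.mp hj).1, Nat.gcd_zero_left]

/-- The largest invariant factor annihilates the torsion of the cokernel. -/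
theorem HasSmithForm.exists_mulVec_eq_smul {M : Matrix ι κ ℤ} {r : ℕ} {d : ℕ → ℕ}
    (h : HasSmithForm M r d) {δ : ℤ} (hδ : ∀ j < r, (d j : ℤ) ∣ δ) {m : ℤ} (hm : m ≠ 0)
    {x : κ → ℤ} {z : ι → ℤ} (hx : M *ᵥ x = m • z) : ∃ y, M *ᵥ y = δ • z := by
  obtain ⟨h1, h2, h3, P, Q, e, f, h4⟩ := h
  have hPx : (∑ k : Fin r, Matrix.single (e k) (f k) (d k : ℤ)) *ᵥ
      (((Q⁻¹ : (Matrix κ κ ℤ)ˣ) : Matrix κ κ ℤ) *ᵥ x) = m • ((P : Matrix ι ι ℤ) *ᵥ z) := by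
    rw [← h4, Matrix.mulVec_mulVec, Matrix.mul_assoc, Units.mul_inv, Matrix.mul_one,
      ← Matrix.mulVec_mulVec, hx, Matrix.mulVec_smul]
  choose t ht using hδ
  -- In pivot coordinates the solution is forced: `t k` is the quotient `δ / d k`.
  let y' : κ → ℤ := fun j => ∑ k : Fin r,
    if f k = j then t k k.2 * ((P : Matrix ι ι ℤ) *ᵥ z) (e k) else 0
  have hy' : ∀ k, y' (f k) = t k k.2 * ((P : Matrix ι ι ℤ) *ᵥ z) (e k) := by
    intro k
    simp [y', f.injective.eq_iff]
  have hD : (∑ k : Fin r, Matrix.single (e k) (f k) (d k : ℤ)) *ᵥ y' =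
      δ • ((P : Matrix ι ι ℤ) *ᵥ z) := by
    ext i
    by_cases hi : ∃ k, e k = i
    · obtain ⟨k, rfl⟩ := hi
      rw [sum_single_mulVec_apply, hy', ← mul_assoc, ← ht k k.2]
      simp
    -- A row without pivot is zero, so the given solution forces `m * (P z) i = 0`, and `m ≠ 0`.
    · have h5 := congrFun hPx i
      push Not at hi
      rw [sum_single_mulVec, Finset.sum_eq_zero (fun k _ => by simp [hi])] at h5 ⊢
      simp only [Pi.smul_apply, smul_eq_mul] at h5 ⊢
      rcases mul_eq_zero.mp h5.symm with h6 | h6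
      · exact absurd h6 hm
      · rw [h6, mul_zero]
  refine ⟨(Q : Matrix κ κ ℤ) *ᵥ y', ?_⟩
  rw [← h4, ← Matrix.mulVec_mulVec, ← Matrix.mulVec_mulVec] at hD
  have := congrArg (fun v => ((P⁻¹ : (Matrix ι ι ℤ)ˣ) : Matrix ι ι ℤ) *ᵥ v) hD
  simpa only [Matrix.mulVec_mulVec, Matrix.mulVec_smul, ← Matrix.mul_assoc, Units.inv_mul,
    Matrix.one_mul, Matrix.one_mulVec] using this

/-- Solvability of a rationally solvable system modulo `q` depends only on `gcd (q, δ)`. -/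
theorem mem_colSpaceMod_of_gcd_eq {M : Matrix ι κ ℤ} {c : ι → ℤ} {r : ℕ} {d : ℕ → ℕ}
    (h : HasSmithForm M r d) {δ : ℕ} (hδ : ∀ j < r, d j ∣ δ)
    (hrank : intRank (Matrix.fromCols M (Matrix.replicateCol Unit c)) = intRank M)
    {q k : ℕ} (hq : 0 < q) (hqk : q.gcd δ = k.gcd δ) (hc : vecMod q c ∈ colSpaceMod q M) :
    vecMod k c ∈ colSpaceMod k M := by
  obtain ⟨m, x₀, hm, hx₀⟩ := exists_mulVec_eq_smul_of_rank hrank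
  have hg := mem_colSpaceMod_of_dvd (Nat.gcd_dvd_left q δ) hc
  have hgpos : 0 < q.gcd δ := Nat.gcd_pos_of_pos_left _ hq
  rw [mem_colSpaceMod_iff] at hg ⊢
  obtain ⟨x, z, hxz⟩ := hg
  -- With `g = gcd(q, δ)` and `M x + g z = c`, the class of `z` is torsion in the cokernel of `M`,
  -- so `δ z` is in the column lattice.
  have h1 : M *ᵥ (x₀ - m • x) = (m * (q.gcd δ : ℤ)) • z := by
    rw [Matrix.mulVec_sub, hx₀, Matrix.mulVec_smul, ← hxz, smul_add, mul_smul]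
    abel
  obtain ⟨y, hy⟩ := h.exists_mulVec_eq_smul (δ := δ) (fun j hj => by exact_mod_cast hδ j hj)
    (mul_ne_zero hm (by exact_mod_cast hgpos.ne')) h1
  -- Write `g = k A + δ B`: the part `δ B z` is absorbed into the columns, and `k A z` vanishes
  -- modulo `k`.
  have hbez := Nat.gcd_eq_gcd_ab k δ
  rw [← hqk] at hbez
  refine ⟨x + k.gcdB δ • y, k.gcdA δ • z, ?_⟩
  rw [Matrix.mulVec_add, Matrix.mulVec_smul, hy, ← hxz, hbez]
  module

end Counting

/-! ### Whitney's broken circuit theorem for affine arrangements. -/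

section Whitney

open Classical

variable {n : ℕ} {V : AffineSubspace ℝ (Fin n → ℝ)}
  {𝓐 S : Finset (AffineSubspace ℝ (Fin n → ℝ))}
  {prec : AffineSubspace ℝ (Fin n → ℝ) → AffineSubspace ℝ (Fin n → ℝ) → Prop}

theorem interIn_mono {S T : Finset (AffineSubspace ℝ (Fin n → ℝ))} (h : S ⊆ T) :
    interIn V T ≤ interIn V S :=
  inf_le_inf_left _ (Finset.inf_mono h)

theorem interIn_le {H : AffineSubspace ℝ (Fin n → ℝ)} (h : H ∈ S) : interIn V S ≤ H :=
  inf_le_right.trans (Finset.inf_le (f := id) h)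

theorem le_interIn {W : AffineSubspace ℝ (Fin n → ℝ)} (hV : W ≤ V) (h : ∀ H ∈ S, W ≤ H) :
    W ≤ interIn V S :=
  le_inf hV (Finset.le_inf h)

theorem interIn_empty : interIn V ∅ = V := by
  rw [interIn, Finset.inf_empty, inf_top_eq]

theorem interIn_insert (K : AffineSubspace ℝ (Fin n → ℝ)) :
    interIn V (insert K S) = K ⊓ interIn V S := by
  rw [interIn, interIn, Finset.inf_insert, id, inf_left_comm]

theorem interIn_insert_eq_of_le {K : AffineSubspace ℝ (Fin n → ℝ)} (h : interIn V S ≤ K) :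
    interIn V (insert K S) = interIn V S := by
  rw [interIn_insert, inf_eq_right.mpr h]

theorem IsCentralIn.mono {S T : Finset (AffineSubspace ℝ (Fin n → ℝ))} (hT : IsCentralIn V T)
    (h : S ⊆ T) : IsCentralIn V S :=
  Set.Nonempty.mono (interIn_mono h) hT

/-- The dimension formula for the sum and the intersection of the two directions, whose sum lies in
the direction of `V`. -/
theorem finrank_direction_le_of_isCodimOne {K W : AffineSubspace ℝ (Fin n → ℝ)}
    (hK : IsCodimOne K V) (hW : W ≤ V) (h : ((K ⊓ W : AffineSubspace ℝ (Fin n → ℝ)) :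
      Set (Fin n → ℝ)).Nonempty) :
    finrank ℝ W.direction ≤ finrank ℝ (K ⊓ W).direction + 1 := by
  obtain ⟨p, hp⟩ := h
  rw [AffineSubspace.direction_inf_of_mem_inf hp]
  have h1 := Submodule.finrank_sup_add_finrank_inf_eq K.direction W.direction
  have h2 : K.direction ⊔ W.direction ≤ V.direction :=
    sup_le (AffineSubspace.direction_le hK.1) (AffineSubspace.direction_le hW)
  have h3 := Submodule.finrank_mono h2
  have h4 := hK.2.2
  omega

theorem finrank_le_interIn_add_card (h𝓐 : ∀ H ∈ S, IsCodimOne H V) (hS : IsCentralIn V S) :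
    finrank ℝ V.direction ≤ finrank ℝ (interIn V S).direction + S.card := by
  induction S using Finset.induction_on with
  | empty => rw [interIn_empty]; exact Nat.le_add_right _ _
  | insert K S hK ih =>
    have h1 := ih (fun H hH => h𝓐 H (Finset.mem_insert_of_mem hH))
      (hS.mono (Finset.subset_insert _ _))
    rw [IsCentralIn, interIn_insert] at hS
    have h2 := finrank_direction_le_of_isCodimOne (W := interIn V S)
      (h𝓐 K (Finset.mem_insert_self _ _)) inf_le_left hS
    rw [interIn_insert, Finset.card_insert_of_notMem hK]
    omega

theorem affineSubspace_eq_of_le_of_finrank_le {W W' : AffineSubspace ℝ (Fin n → ℝ)} (h : W' ≤ W)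
    (hne : (W' : Set (Fin n → ℝ)).Nonempty)
    (hf : finrank ℝ W.direction ≤ finrank ℝ W'.direction) : W' = W :=
  AffineSubspace.eq_of_direction_eq_of_nonempty_of_le
    (Submodule.eq_of_le_of_finrank_le (AffineSubspace.direction_le h) hf) hne h

theorem exists_isCircuitIn (hS : S ⊆ 𝓐) (hdep : IsDependentIn V S) :
    ∃ C ⊆ S, IsCircuitIn V 𝓐 C := by
  induction S using Finset.strongInduction with
  | H S ih =>
    by_cases h : ∃ D, D ⊂ S ∧ IsDependentIn V D
    · obtain ⟨D, hDS, hD⟩ := h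
      obtain ⟨C, hC, hC'⟩ := ih D hDS (hDS.1.trans hS) hD
      exact ⟨C, hC.trans hDS.1, hC'⟩
    · push Not at h
      exact ⟨S, subset_rfl, hS, hdep, h⟩

theorem IsCircuitIn.nonempty {C : Finset (AffineSubspace ℝ (Fin n → ℝ))}
    (hC : IsCircuitIn V 𝓐 C) : C.Nonempty := by
  rw [Finset.nonempty_iff_ne_empty]
  rintro rfl
  have := hC.2.1.2
  rw [interIn_empty] at this
  exact lt_irrefl _ this

/-- By minimality `C` without `H` is not dependent, so its intersection is no larger in dimension
than that of `C`. The two coincide and lie in `H`. -/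
theorem IsCircuitIn.interIn_erase_le {C : Finset (AffineSubspace ℝ (Fin n → ℝ))}
    (hC : IsCircuitIn V 𝓐 C) {H : AffineSubspace ℝ (Fin n → ℝ)} (hH : H ∈ C) :
    interIn V (C.erase H) ≤ H := by
  have hcen : IsCentralIn V (C.erase H) := hC.2.1.1.mono (Finset.erase_subset _ _)
  have h1 := hC.2.2 _ (Finset.erase_ssubset hH)
  rw [IsDependentIn, not_and] at h1
  have h2 := h1 hcen
  have h3 := hC.2.1.2
  rw [← Finset.card_erase_add_one hH] at h3
  have h4 := affineSubspace_eq_of_le_of_finrank_le (interIn_mono (V := V)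
    (Finset.erase_subset H C)) hC.2.1.1 (by omega)
  rw [← h4]
  exact interIn_le hH

theorem exists_forall_ne_rel (hprec : IsStrictTotalOrder (AffineSubspace ℝ (Fin n → ℝ)) prec)
    (hS : S.Nonempty) : ∃ H ∈ S, ∀ K ∈ S, K ≠ H → prec K H := by
  induction hS using Finset.Nonempty.cons_induction with
  | singleton a => exact ⟨a, by simp, by simp⟩
  | cons a s ha hs ih =>
    obtain ⟨H, hH, hmax⟩ := ih
    have hne : a ≠ H := fun h => ha (h ▸ hH)
    rcases trichotomous_of prec a H with h | h | h
    · refine ⟨H, by simp [hH], fun K hK hKH => ?_⟩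
      rcases Finset.mem_cons.mp hK with rfl | hK
      · exact h
      · exact hmax K hK hKH
    · exact absurd h hne
    · refine ⟨a, by simp, fun K hK hKa => ?_⟩
      rcases Finset.mem_cons.mp hK with rfl | hK
      · exact absurd rfl hKa
      · by_cases hKH : K = H
        · exact hKH ▸ h
        · exact trans_of prec (hmax K hK hKH) h

/-- `K` contains the intersection of the members of `S` that precede it. -/
def IsActiveIn (prec : AffineSubspace ℝ (Fin n → ℝ) → AffineSubspace ℝ (Fin n → ℝ) → Prop)
    (V : AffineSubspace ℝ (Fin n → ℝ)) (𝓐 S : Finset (AffineSubspace ℝ (Fin n → ℝ)))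
    (K : AffineSubspace ℝ (Fin n → ℝ)) : Prop :=
  K ∈ 𝓐 ∧ interIn V (S.filter fun H => prec H K) ≤ K

theorem IsCircuitIn.isBrokenCircuitIn {C : Finset (AffineSubspace ℝ (Fin n → ℝ))}
    (hC : IsCircuitIn V 𝓐 C) {H : AffineSubspace ℝ (Fin n → ℝ)} (hH : H ∈ C)
    (hmax : ∀ K ∈ C, K ≠ H → prec K H) : IsBrokenCircuitIn prec V 𝓐 (C.erase H) :=
  ⟨C, hC, H, hH, hmax, by simp⟩

theorem exists_isBrokenCircuitIn_of_circuit
    (hprec : IsStrictTotalOrder (AffineSubspace ℝ (Fin n → ℝ)) prec)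
    {C : Finset (AffineSubspace ℝ (Fin n → ℝ))} (hC : IsCircuitIn V 𝓐 C) (hCS : C ⊆ S) :
    ∃ T, IsBrokenCircuitIn prec V 𝓐 T ∧ T ⊆ S := by
  obtain ⟨H, hH, hmax⟩ := exists_forall_ne_rel hprec hC.nonempty
  exact ⟨_, hC.isBrokenCircuitIn hH hmax, (Finset.erase_subset _ _).trans hCS⟩

theorem dependent_insert (h𝓐 : ∀ H ∈ S, IsCodimOne H V) (hS : IsCentralIn V S)
    {K : AffineSubspace ℝ (Fin n → ℝ)} (hK : K ∉ S) (hle : interIn V S ≤ K) :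
    IsDependentIn V (insert K S) := by
  refine ⟨?_, ?_⟩
  · rwa [IsCentralIn, interIn_insert_eq_of_le hle]
  · rw [interIn_insert_eq_of_le hle, Finset.card_insert_of_notMem hK]
    have := finrank_le_interIn_add_card h𝓐 hS
    omega

/-- The largest element of a circuit contains the intersection of the others, hence is active as
soon as the broken circuit is in `S`. Conversely, an active `K` is dependent on the members before
it. A circuit among these either has `K` as its largest element, so that removing `K` leaves a
subset of `S`, or lies in `S` itself. -/
theorem exists_isBrokenCircuitIn_iff
    (hprec : IsStrictTotalOrder (AffineSubspace ℝ (Fin n → ℝ)) prec)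
    (h𝓐 : ∀ H ∈ 𝓐, IsCodimOne H V) (hS : S ⊆ 𝓐) (hcen : IsCentralIn V S) :
    (∃ T, IsBrokenCircuitIn prec V 𝓐 T ∧ T ⊆ S) ↔ ∃ K, IsActiveIn prec V 𝓐 S K := by
  constructor
  · rintro ⟨T, ⟨C, hC, H, hH, hmax, hT⟩, hTS⟩
    have hT' : T = C.erase H := by
      rw [← Finset.coe_inj, hT]; simp
    refine ⟨H, hC.1 hH, (interIn_mono ?_).trans (hC.interIn_erase_le hH)⟩
    intro K hK
    rw [Finset.mem_filter]
    exact ⟨hTS (hT' ▸ hK), hmax K (Finset.mem_of_mem_erase hK) (Finset.ne_of_mem_erase hK)⟩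
  · rintro ⟨K, hK𝓐, hK⟩
    set U := S.filter fun H => prec H K with hU
    have hUS : U ⊆ S := Finset.filter_subset _ _
    have hKU : K ∉ U := by
      rw [hU, Finset.mem_filter]
      exact fun h => irrefl_of prec K h.2
    have hdep := dependent_insert (fun H hH => h𝓐 H (hS (hUS hH))) (hcen.mono hUS) hKU hK
    obtain ⟨C, hCU, hC⟩ := exists_isCircuitIn (𝓐 := 𝓐)
      (Finset.insert_subset hK𝓐 (hUS.trans hS)) hdep
    by_cases hKC : K ∈ C
    · refine ⟨C.erase K, hC.isBrokenCircuitIn hKC fun H hH hHK => ?_, fun H hH => ?_⟩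
      · exact (Finset.mem_filter.mp ((Finset.mem_insert.mp (hCU hH)).resolve_left hHK)).2
      · exact hUS ((Finset.mem_insert.mp (hCU (Finset.mem_of_mem_erase hH))).resolve_left
          (Finset.ne_of_mem_erase hH))
    · refine exists_isBrokenCircuitIn_of_circuit hprec hC fun H hH => ?_
      exact hUS ((Finset.mem_insert.mp (hCU hH)).resolve_left fun h => hKC (h ▸ hH))

theorem finrank_eq_of_no_active
    (hprec : IsStrictTotalOrder (AffineSubspace ℝ (Fin n → ℝ)) prec)
    (h𝓐 : ∀ H ∈ 𝓐, IsCodimOne H V) (hS : S ⊆ 𝓐) (hcen : IsCentralIn V S)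
    (hact : ¬ ∃ K, IsActiveIn prec V 𝓐 S K) :
    finrank ℝ V.direction = finrank ℝ (interIn V S).direction + S.card := by
  refine le_antisymm (finrank_le_interIn_add_card (fun H hH => h𝓐 H (hS hH)) hcen) ?_
  by_contra! hlt
  obtain ⟨C, hCS, hC⟩ := exists_isCircuitIn hS ⟨hcen, hlt⟩
  exact hact ((exists_isBrokenCircuitIn_iff hprec h𝓐 hS hcen).mp
    (exists_isBrokenCircuitIn_of_circuit hprec hC hCS))

/-- Add `K` to `S` if it is not in `S`, and remove it otherwise. -/
noncomputable def toggle (K : AffineSubspace ℝ (Fin n → ℝ))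
    (S : Finset (AffineSubspace ℝ (Fin n → ℝ))) : Finset (AffineSubspace ℝ (Fin n → ℝ)) :=
  if K ∈ S then S.erase K else insert K S

theorem toggle_toggle (K : AffineSubspace ℝ (Fin n → ℝ)) : toggle K (toggle K S) = S := by
  by_cases h : K ∈ S
  · simp [toggle, h]
  · simp [toggle, h]

theorem neg_one_pow_card_toggle (K : AffineSubspace ℝ (Fin n → ℝ)) :
    (-1 : ℤ) ^ (toggle K S).card = -(-1) ^ S.card := by
  by_cases h : K ∈ S
  · rw [toggle, if_pos h, ← Finset.card_erase_add_one h]; ring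
  · rw [toggle, if_neg h, Finset.card_insert_of_notMem h]; ring

theorem toggle_ne (K : AffineSubspace ℝ (Fin n → ℝ)) : toggle K S ≠ S := by
  intro h
  have := neg_one_pow_card_toggle (S := S) K
  rw [h] at this
  have h0 : (-1 : ℤ) ^ S.card ≠ 0 := pow_ne_zero _ (by norm_num)
  omega

theorem filter_toggle {K : AffineSubspace ℝ (Fin n → ℝ)}
    {p : AffineSubspace ℝ (Fin n → ℝ) → Prop} (hK : ¬ p K) :
    (toggle K S).filter p = S.filter p := by
  unfold toggle
  split_ifs with h
  · rw [Finset.filter_erase, Finset.erase_eq_of_notMem (by simp [hK])]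
  · rw [Finset.filter_insert, if_neg hK]

theorem filter_toggle_of_pos {K : AffineSubspace ℝ (Fin n → ℝ)}
    {p : AffineSubspace ℝ (Fin n → ℝ) → Prop} (hK : p K) :
    (toggle K S).filter p = toggle K (S.filter p) := by
  unfold toggle
  by_cases h : K ∈ S
  · rw [if_pos h, if_pos (by simp [h, hK]), Finset.filter_erase]
  · rw [if_neg h, if_neg (by simp [h]), Finset.filter_insert, if_pos hK]

/-- The set `U` survives the toggle and already confines the intersection to `K`. -/
theorem interIn_toggle {K : AffineSubspace ℝ (Fin n → ℝ)}
    {U : Finset (AffineSubspace ℝ (Fin n → ℝ))} (hUS : U ⊆ S) (hKU : K ∉ U)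
    (hle : interIn V U ≤ K) : interIn V (toggle K S) = interIn V S := by
  unfold toggle
  split_ifs with h
  · have h1 : interIn V (S.erase K) ≤ K := by
      refine (interIn_mono fun H hH => ?_).trans hle
      exact Finset.mem_erase.mpr ⟨fun e => hKU (e ▸ hH), hUS hH⟩
    conv_rhs => rw [← Finset.insert_erase h]
    rw [interIn_insert_eq_of_le h1]
  · exact interIn_insert_eq_of_le ((interIn_mono hUS).trans hle)

theorem notMem_filter_rel (hprec : IsStrictTotalOrder (AffineSubspace ℝ (Fin n → ℝ)) prec)
    (K : AffineSubspace ℝ (Fin n → ℝ)) : K ∉ S.filter fun H => prec H K := by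
  rw [Finset.mem_filter]
  exact fun h => irrefl_of prec K h.2

theorem IsActiveIn.interIn_toggle
    (hprec : IsStrictTotalOrder (AffineSubspace ℝ (Fin n → ℝ)) prec)
    {K : AffineSubspace ℝ (Fin n → ℝ)} (hK : IsActiveIn prec V 𝓐 S K) :
    interIn V (toggle K S) = interIn V S :=
  _root_.interIn_toggle (Finset.filter_subset _ _) (notMem_filter_rel hprec K) hK.2

/-- If `K` precedes `K'`, then so do the members of `S` before `K`, whose intersection lies in `K`;
toggling `K` does not change the intersection before `K'`. Otherwise the members before `K'` are the
same. Thus the set of active elements is invariant, which makes toggling the largest one an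
involution. -/
theorem IsActiveIn.toggle_iff
    (hprec : IsStrictTotalOrder (AffineSubspace ℝ (Fin n → ℝ)) prec)
    {K K' : AffineSubspace ℝ (Fin n → ℝ)} (hK : IsActiveIn prec V 𝓐 S K) :
    IsActiveIn prec V 𝓐 (toggle K S) K' ↔ IsActiveIn prec V 𝓐 S K' := by
  unfold IsActiveIn
  by_cases h : prec K K'
  · rw [filter_toggle_of_pos (p := fun H => prec H K') h,
      _root_.interIn_toggle _ (notMem_filter_rel (S := S) hprec K) hK.2]
    intro H hH
    rw [Finset.mem_filter] at hH ⊢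
    exact ⟨hH.1, trans_of prec hH.2 h⟩
  · rw [filter_toggle (p := fun H => prec H K') h]

/-- `K` is the largest active element of `S`. -/
def IsMaxActiveIn (prec : AffineSubspace ℝ (Fin n → ℝ) → AffineSubspace ℝ (Fin n → ℝ) → Prop)
    (V : AffineSubspace ℝ (Fin n → ℝ)) (𝓐 S : Finset (AffineSubspace ℝ (Fin n → ℝ)))
    (K : AffineSubspace ℝ (Fin n → ℝ)) : Prop :=
  IsActiveIn prec V 𝓐 S K ∧ ∀ K', IsActiveIn prec V 𝓐 S K' → K' ≠ K → prec K' K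

theorem exists_isMaxActiveIn (hprec : IsStrictTotalOrder (AffineSubspace ℝ (Fin n → ℝ)) prec)
    (h : ∃ K, IsActiveIn prec V 𝓐 S K) : ∃ K, IsMaxActiveIn prec V 𝓐 S K := by
  obtain ⟨K, hK⟩ := h
  obtain ⟨H, hH, hmax⟩ := exists_forall_ne_rel (S := 𝓐.filter fun K => IsActiveIn prec V 𝓐 S K)
    hprec ⟨K, by simp [hK, hK.1]⟩
  refine ⟨H, (Finset.mem_filter.mp hH).2, fun K' hK' hne => hmax K' ?_ hne⟩
  exact Finset.mem_filter.mpr ⟨hK'.1, hK'⟩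

theorem IsMaxActiveIn.unique (hprec : IsStrictTotalOrder (AffineSubspace ℝ (Fin n → ℝ)) prec)
    {K K' : AffineSubspace ℝ (Fin n → ℝ)} (hK : IsMaxActiveIn prec V 𝓐 S K)
    (hK' : IsMaxActiveIn prec V 𝓐 S K') : K = K' := by
  by_contra hne
  exact irrefl_of prec K (trans_of prec (hK'.2 K hK.1 hne) (hK.2 K' hK'.1 (Ne.symm hne)))

theorem IsMaxActiveIn.toggle (hprec : IsStrictTotalOrder (AffineSubspace ℝ (Fin n → ℝ)) prec)
    {K : AffineSubspace ℝ (Fin n → ℝ)} (hK : IsMaxActiveIn prec V 𝓐 S K) :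
    IsMaxActiveIn prec V 𝓐 (toggle K S) K := by
  exact ⟨(hK.1.toggle_iff hprec).mpr hK.1,
    fun K' hK' hne => hK.2 K' ((hK.1.toggle_iff hprec).mp hK') hne⟩

/-- The largest active element of `S`. -/
noncomputable def maxActive
    (prec : AffineSubspace ℝ (Fin n → ℝ) → AffineSubspace ℝ (Fin n → ℝ) → Prop)
    (V : AffineSubspace ℝ (Fin n → ℝ)) (𝓐 S : Finset (AffineSubspace ℝ (Fin n → ℝ))) :
    AffineSubspace ℝ (Fin n → ℝ) :=
  if h : ∃ K, IsMaxActiveIn prec V 𝓐 S K then h.choose else V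

theorem IsMaxActiveIn.maxActive_eq
    (hprec : IsStrictTotalOrder (AffineSubspace ℝ (Fin n → ℝ)) prec)
    {K : AffineSubspace ℝ (Fin n → ℝ)} (hK : IsMaxActiveIn prec V 𝓐 S K) :
    maxActive prec V 𝓐 S = K := by
  have h : ∃ K, IsMaxActiveIn prec V 𝓐 S K := ⟨K, hK⟩
  rw [maxActive, dif_pos h]
  exact h.choose_spec.unique hprec hK

/-- The central subsets of `𝓐` whose intersection has codimension `k` in `V`. -/
noncomputable def centralOfCodim (V : AffineSubspace ℝ (Fin n → ℝ))
    (𝓐 : Finset (AffineSubspace ℝ (Fin n → ℝ))) (k : ℕ) :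
    Finset (Finset (AffineSubspace ℝ (Fin n → ℝ))) :=
  𝓐.powerset.filter fun S => IsCentralIn V S ∧
    finrank ℝ (interIn V S).direction + k = finrank ℝ V.direction

/-- Toggling the largest active element is a fixed-point-free involution that reverses the sign and
preserves the intersection, hence centrality and codimension. -/
theorem sum_active_eq_zero (hprec : IsStrictTotalOrder (AffineSubspace ℝ (Fin n → ℝ)) prec)
    (k : ℕ) :
    ∑ S ∈ (centralOfCodim V 𝓐 k).filter fun S => ∃ K, IsActiveIn prec V 𝓐 S K,
      (-1 : ℤ) ^ S.card = 0 := by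
  have key : ∀ S ∈ (centralOfCodim V 𝓐 k).filter fun S => ∃ K, IsActiveIn prec V 𝓐 S K,
      IsMaxActiveIn prec V 𝓐 S (maxActive prec V 𝓐 S) := by
    intro S hS
    obtain ⟨K, hK⟩ := exists_isMaxActiveIn hprec (Finset.mem_filter.mp hS).2
    rwa [hK.maxActive_eq hprec]
  refine Finset.sum_involution (fun S _ => toggle (maxActive prec V 𝓐 S) S) ?_ ?_ ?_ ?_
  · intro S _
    rw [neg_one_pow_card_toggle]; ring
  · intro S _ _
    exact toggle_ne _
  · intro S hS
    have hK := key S hS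
    simp only [centralOfCodim, Finset.mem_filter, Finset.mem_powerset] at hS ⊢
    refine ⟨⟨?_, ?_⟩, _, (hK.toggle hprec).1⟩
    · unfold toggle
      split_ifs
      · exact (Finset.erase_subset _ _).trans hS.1.1
      · exact Finset.insert_subset hK.1.1 hS.1.1
    · rw [IsCentralIn, hK.1.interIn_toggle hprec]
      exact hS.1.2
  · intro S hS
    rw [((key S hS).toggle hprec).maxActive_eq hprec, toggle_toggle]

/-- Whitney's broken circuit theorem for affine arrangements. -/
theorem sum_centralOfCodim (hprec : IsStrictTotalOrder (AffineSubspace ℝ (Fin n → ℝ)) prec)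
    (h𝓐 : ∀ H ∈ 𝓐, IsCodimOne H V) (k : ℕ) :
    ∑ S ∈ centralOfCodim V 𝓐 k, (-1 : ℤ) ^ S.card = (-1) ^ k * nbcCount prec V 𝓐 k := by
  rw [← Finset.sum_filter_add_sum_filter_not _ (fun S => ∃ K, IsActiveIn prec V 𝓐 S K),
    sum_active_eq_zero hprec, zero_add]
  -- The sets left over have no active element, so they are independent: their cardinality equals
  -- the codimension `k`.
  have hset : {S : Finset (AffineSubspace ℝ (Fin n → ℝ)) |
      S ⊆ 𝓐 ∧ S.card = k ∧ IsCentralIn V S ∧ ∀ T, IsBrokenCircuitIn prec V 𝓐 T → ¬ T ⊆ S} =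
      ((centralOfCodim V 𝓐 k).filter fun S => ¬ ∃ K, IsActiveIn prec V 𝓐 S K : Finset _) := by
    ext S
    simp only [centralOfCodim, Set.mem_ofPred_eq, Finset.coe_filter, Finset.mem_filter,
      Finset.mem_powerset]
    constructor
    · rintro ⟨h1, h2, h3, h4⟩
      have h5 : ¬ ∃ K, IsActiveIn prec V 𝓐 S K := by
        rw [← exists_isBrokenCircuitIn_iff hprec h𝓐 h1 h3]
        rintro ⟨T, hT, hTS⟩
        exact h4 T hT hTS
      refine ⟨⟨h1, h3, ?_⟩, h5⟩
      rw [finrank_eq_of_no_active hprec h𝓐 h1 h3 h5, h2]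
    · rintro ⟨⟨h1, h3, h2⟩, h5⟩
      refine ⟨h1, ?_, h3, ?_⟩
      · have := finrank_eq_of_no_active hprec h𝓐 h1 h3 h5
        omega
      · rw [← exists_isBrokenCircuitIn_iff hprec h𝓐 h1 h3] at h5
        exact fun T hT hTS => h5 ⟨T, hT, hTS⟩
  rw [nbcCount, hset, Set.ncard_coe_finset, Finset.sum_congr rfl (g := fun _ => (-1 : ℤ) ^ k)]
  · simp [mul_comm]
  · intro S hS
    have : S ∈ ((centralOfCodim V 𝓐 k).filter fun S => ¬ ∃ K, IsActiveIn prec V 𝓐 S K :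
      Finset _) := hS
    rw [← Finset.mem_coe, ← hset] at this
    rw [this.2.1]

/-- The hyperplanes through a flat contain a spanning subset without broken circuits. -/
theorem nbcCount_pos (hprec : IsStrictTotalOrder (AffineSubspace ℝ (Fin n → ℝ)) prec)
    (h𝓐 : ∀ H ∈ 𝓐, IsCodimOne H V) (hS : S ⊆ 𝓐) (hcen : IsCentralIn V S) {k : ℕ}
    (hk : finrank ℝ (interIn V S).direction + k = finrank ℝ V.direction) :
    0 < nbcCount prec V 𝓐 k := by
  set X := interIn V S with hX
  let 𝓑 := 𝓐.filter fun H => X ≤ H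
  have hXV : X ≤ V := inf_le_left
  -- Greedy choice from the largest hyperplane downwards: keep `H` unless it contains the
  -- intersection of the later members of `𝓑`.
  let T := 𝓑.filter fun H => ¬ interIn V (𝓑.filter fun K => prec H K) ≤ H
  have hT𝓑 : T ⊆ 𝓑 := Finset.filter_subset _ _
  have hT𝓐 : T ⊆ 𝓐 := hT𝓑.trans (Finset.filter_subset _ _)
  have hXT : X ≤ interIn V T :=
    le_interIn hXV fun H hH => (Finset.mem_filter.mp (hT𝓑 hH)).2
  have hTcen : IsCentralIn V T := Set.Nonempty.mono hXT hcen
  have hswap : IsStrictTotalOrder (AffineSubspace ℝ (Fin n → ℝ)) (Function.swap prec) :=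
    inferInstance
  -- In the largest counterexample `H`, all later members of `𝓑` contain the intersection of `T`;
  -- then `H` contains it too, whether `H` was kept or discarded.
  have hle : ∀ H ∈ 𝓑, interIn V T ≤ H := by
    by_contra! hcon
    obtain ⟨H₀, hH₀, hH₀'⟩ := hcon
    obtain ⟨H, hH, hmax⟩ := exists_forall_ne_rel (S := 𝓑.filter fun H => ¬ interIn V T ≤ H)
      hprec ⟨H₀, by simp [hH₀, hH₀']⟩
    rw [Finset.mem_filter] at hH
    have h1 : interIn V T ≤ interIn V (𝓑.filter fun K => prec H K) := by
      refine le_interIn inf_le_left fun K hK => ?_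
      rw [Finset.mem_filter] at hK
      by_contra hcon
      have hne : K ≠ H := fun e => irrefl_of prec H (by rw [e] at hK; exact hK.2)
      exact irrefl_of prec H (trans_of prec hK.2
        (hmax K (Finset.mem_filter.mpr ⟨hK.1, hcon⟩) hne))
    by_cases hHT : H ∈ T
    · exact hH.2 (interIn_le hHT)
    · have : interIn V (𝓑.filter fun K => prec H K) ≤ H := by
        by_contra h2
        exact hHT (Finset.mem_filter.mpr ⟨hH.1, h2⟩)
      exact hH.2 (h1.trans this)
  have hTX : interIn V T = X := by
    refine le_antisymm (le_interIn inf_le_left fun H hH => hle H ?_) hXT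
    exact Finset.mem_filter.mpr ⟨hS hH, interIn_le hH⟩
  -- An active `K` gives a circuit in `𝓑` whose least element contains the intersection of the later
  -- ones, and so was discarded. That element must be `K`, but the other members precede `K`. The
  -- circuit is then `{K}`, which forces `V ≤ K` against codimension one.
  have hact : ¬ ∃ K, IsActiveIn prec V 𝓐 T K := by
    rintro ⟨K, hK𝓐, hK⟩
    set U := T.filter fun H => prec H K with hU
    have hUT : U ⊆ T := Finset.filter_subset _ _
    have hKU : K ∉ U := notMem_filter_rel hprec K
    have hK𝓑 : K ∈ 𝓑 := Finset.mem_filter.mpr ⟨hK𝓐, hXT.trans ((interIn_mono hUT).trans hK)⟩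
    have hdep := dependent_insert (fun H hH => h𝓐 H (hT𝓐 (hUT hH))) (hTcen.mono hUT) hKU hK
    obtain ⟨C, hCU, hC⟩ := exists_isCircuitIn (𝓐 := 𝓐)
      (Finset.insert_subset hK𝓐 (hUT.trans hT𝓐)) hdep
    have hC𝓑 : C ⊆ 𝓑 := hCU.trans (Finset.insert_subset hK𝓑 (hUT.trans hT𝓑))
    obtain ⟨H, hH, hmin⟩ := exists_forall_ne_rel (prec := Function.swap prec) hswap hC.nonempty
    have h1 : interIn V (𝓑.filter fun K => prec H K) ≤ H := by
      refine (interIn_mono fun K hK => ?_).trans (hC.interIn_erase_le hH)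
      exact Finset.mem_filter.mpr ⟨hC𝓑 (Finset.mem_of_mem_erase hK),
        hmin K (Finset.mem_of_mem_erase hK) (Finset.ne_of_mem_erase hK)⟩
    have hHT : H ∉ T := fun h => (Finset.mem_filter.mp h).2 h1
    have hHK : H = K := by
      rcases Finset.mem_insert.mp (hCU hH) with h | h
      · exact h
      · exact absurd (hUT h) hHT
    have hCK : C.erase H = ∅ := by
      refine Finset.eq_empty_of_forall_notMem fun L hL => ?_
      have h2 := hmin L (Finset.mem_of_mem_erase hL) (Finset.ne_of_mem_erase hL)
      rcases Finset.mem_insert.mp (hCU (Finset.mem_of_mem_erase hL)) with h | h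
      · exact Finset.ne_of_mem_erase hL (h.trans hHK.symm)
      · have h3 := (Finset.mem_filter.mp h).2
        rw [← hHK] at h3
        exact irrefl_of prec L (trans_of prec h3 h2)
    have h4 := hC.interIn_erase_le hH
    rw [hCK] at h4
    have h5 : V ≤ H := by simpa [interIn_empty] using h4
    have h6 := h𝓐 H (hC.1 hH)
    have h7 : H = V := le_antisymm h6.1 h5
    have h8 := h6.2.2
    rw [h7] at h8
    omega
  have hcard := finrank_eq_of_no_active hprec h𝓐 hT𝓐 hTcen hact
  rw [hTX] at hcard
  rw [nbcCount, Set.ncard_pos ((Finset.finite_toSet 𝓐.powerset).subset fun S hS => by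
    simpa using hS.1)]
  refine ⟨T, hT𝓐, by omega, hTcen, fun Z hZ hZT => hact ?_⟩
  exact (exists_isBrokenCircuitIn_iff hprec h𝓐 hT𝓐 hTcen).mp ⟨Z, hZ, hZT⟩

/-- Summing over the sets of indices with a given image. -/
theorem sum_image_eq {α : Type} {β : Type} [DecidableEq α] [DecidableEq β] (f : α → β)
    (Z : Finset α) : ∀ S ⊆ Z.image f,
    ∑ J ∈ Z.powerset.filter (fun J => J.image f = S), (-1 : ℤ) ^ J.card = (-1) ^ S.card := by
  induction Z using Finset.induction_on with
  | empty =>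
    intro S hS
    have : S = ∅ := by simpa using hS
    subst this
    simp [Finset.filter_singleton]
  | insert i Z hi ih =>
    intro S hS
    rw [Finset.sum_filter, Finset.sum_powerset_insert hi]
    have e1 : ∀ T ∈ Z.powerset, (if (insert i T).image f = S then (-1 : ℤ) ^ (insert i T).card
        else 0) = -(if insert (f i) (T.image f) = S then (-1) ^ T.card else 0) := by
      intro T hT
      have hiT : i ∉ T := fun h => hi (Finset.mem_powerset.mp hT h)
      rw [Finset.image_insert, Finset.card_insert_of_notMem hiT]
      split_ifs <;> ring
    rw [Finset.sum_congr rfl e1, Finset.sum_neg_distrib]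
    -- The sets not containing `i` with image `S` cancel against their union with `i`. There remain
    -- the `T` whose image is `S` without `f i`, to which the induction hypothesis applies.
    by_cases hfS : f i ∈ S
    · have e2 : ∀ T ∈ Z.powerset,
          (if insert (f i) (T.image f) = S then (-1 : ℤ) ^ T.card else 0) =
          (if T.image f = S then (-1) ^ T.card else 0) +
          (if T.image f = S.erase (f i) then (-1) ^ T.card else 0) := by
        intro T _
        by_cases h1 : T.image f = S
        · have h2 : insert (f i) (T.image f) = S := by rw [h1, Finset.insert_eq_of_mem hfS]
          have h3 : ¬ T.image f = S.erase (f i) := by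
            intro h; rw [h1] at h
            exact Finset.notMem_erase (f i) S (h ▸ hfS)
          rw [if_pos h1, if_pos h2, if_neg h3, add_zero]
        · rw [if_neg h1, zero_add]
          refine if_congr ⟨fun h => ?_, fun h => ?_⟩ rfl rfl
          · have h4 : f i ∉ T.image f := fun h5 => h1 (by
              rwa [Finset.insert_eq_of_mem h5] at h)
            rw [← h, Finset.erase_insert h4]
          · rw [h, Finset.insert_erase hfS]
      rw [Finset.sum_congr rfl e2, Finset.sum_add_distrib, ← Finset.sum_filter,
        ← Finset.sum_filter (fun T : Finset α => T.image f = S.erase (f i)), ih (S.erase (f i)),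
        ← Finset.card_erase_add_one hfS]
      · ring
      · intro b hb
        have := hS (Finset.mem_of_mem_erase hb)
        rw [Finset.image_insert, Finset.mem_insert] at this
        exact this.resolve_left (Finset.ne_of_mem_erase hb)
    · have e2 : ∀ T ∈ Z.powerset,
          (if insert (f i) (T.image f) = S then (-1 : ℤ) ^ T.card else 0) = 0 := by
        intro T _
        refine if_neg fun h => hfS ?_
        rw [← h]
        exact Finset.mem_insert_self _ _
      rw [Finset.sum_congr rfl e2, ← Finset.sum_filter, ih S]
      · simp
      · intro b hb
        have := hS hb
        rw [Finset.image_insert, Finset.mem_insert] at this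
        exact this.resolve_left fun h => hfS (h ▸ hb)

end Whitney

/-! ### Real solution spaces and ranks. -/

theorem mem_solSpace {ι : Type} {n : ℕ} {M : Matrix ι (Fin n) ℤ} {c : ι → ℤ} {x : Fin n → ℝ} :
    x ∈ solSpace M c ↔ M.map (Int.cast : ℤ → ℝ) *ᵥ x = fun i => (c i : ℝ) :=
  Iff.rfl

theorem direction_solSpace {ι : Type} {n : ℕ} {M : Matrix ι (Fin n) ℤ}
    {c : ι → ℤ} (h : (solSpace M c : Set (Fin n → ℝ)).Nonempty) :
    (solSpace M c).direction = LinearMap.ker (M.map (Int.cast : ℤ → ℝ)).mulVecLin := by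
  obtain ⟨p, hp⟩ := h
  ext v
  rw [LinearMap.mem_ker, Matrix.mulVecLin_apply, ← AffineSubspace.vadd_mem_iff_mem_direction v hp,
    mem_solSpace]
  have hp' : M.map (Int.cast : ℤ → ℝ) *ᵥ p = fun i => (c i : ℝ) := hp
  rw [vadd_eq_add, Matrix.mulVec_add, hp', add_eq_right]

theorem finrank_ker_add_intRank {ι : Type} [Fintype ι] [DecidableEq ι] {n : ℕ}
    (M : Matrix ι (Fin n) ℤ) :
    finrank ℝ (LinearMap.ker (M.map (Int.cast : ℤ → ℝ)).mulVecLin) + intRank M = n := by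
  have h := LinearMap.finrank_range_add_finrank_ker (M.map (Int.cast : ℤ → ℝ)).mulVecLin
  have h2 := rank_map_eq_intRank M ℝ
  rw [Matrix.rank] at h2
  rw [h2] at h
  simpa [add_comm] using h

theorem range_fromCols_le {ι κ K : Type} [Fintype κ] [Field K] (M : Matrix ι κ K)
    (c : ι → K) : LinearMap.range (Matrix.fromCols M (Matrix.replicateCol Unit c)).mulVecLin ≤
      LinearMap.range M.mulVecLin ⊔ Submodule.span K {c} := by
  rintro _ ⟨x, rfl⟩
  rw [Matrix.mulVecLin_apply, fromCols_mulVec_replicateCol]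
  exact Submodule.add_mem_sup ⟨_, rfl⟩
    (Submodule.smul_mem _ _ (Submodule.mem_span_singleton_self c))

theorem intRank_le_fromCols {ι κ : Type} [Fintype ι] [Fintype κ] (M : Matrix ι κ ℤ) (c : ι → ℤ) :
    intRank M ≤ intRank (Matrix.fromCols M (Matrix.replicateCol Unit c)) := by
  rw [intRank, intRank, map_fromCols_replicateCol]
  exact Submodule.finrank_mono (range_le_range_fromCols _ _)

theorem intRank_fromCols_le {ι κ : Type} [Fintype ι] [Fintype κ] (M : Matrix ι κ ℤ) (c : ι → ℤ) :
    intRank (Matrix.fromCols M (Matrix.replicateCol Unit c)) ≤ intRank M + 1 := by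
  rw [intRank, intRank, map_fromCols_replicateCol]
  refine (Submodule.finrank_mono (range_fromCols_le _ _)).trans ?_
  refine (Submodule.finrank_add_le_finrank_add_finrank _ _).trans ?_
  exact Nat.add_le_add_left ((finrank_span_le_card ({fun i => (c i : ℚ)} : Set (ι → ℚ))).trans
    (by simp)) _

theorem solSpace_nonempty_iff {ι : Type} [Fintype ι] [DecidableEq ι] {n : ℕ}
    (M : Matrix ι (Fin n) ℤ) (c : ι → ℤ) :
    (solSpace M c : Set (Fin n → ℝ)).Nonempty ↔
      intRank (Matrix.fromCols M (Matrix.replicateCol Unit c)) = intRank M := by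
  constructor
  · rintro ⟨x, hx⟩
    refine le_antisymm ?_ (intRank_le_fromCols M c)
    rw [← rank_map_eq_intRank _ ℝ, ← rank_map_eq_intRank M ℝ, map_fromCols_replicateCol]
    refine Submodule.finrank_mono ((range_fromCols_le _ _).trans (sup_le le_rfl ?_))
    rw [Submodule.span_singleton_le_iff_mem]
    exact ⟨x, hx⟩
  · intro h
    obtain ⟨k, x, hk, hx⟩ := exists_mulVec_eq_smul_of_rank h
    have hk' : (k : ℝ) ≠ 0 := by exact_mod_cast hk
    refine ⟨(k : ℝ)⁻¹ • fun j => (x j : ℝ), ?_⟩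
    change M.map (Int.cast : ℤ → ℝ) *ᵥ ((k : ℝ)⁻¹ • fun j => (x j : ℝ)) = fun i => (c i : ℝ)
    rw [Matrix.mulVec_smul]
    ext i
    have h1 := congrFun hx i
    have h2 : ((M *ᵥ x) i : ℝ) = (M.map (Int.cast : ℤ → ℝ) *ᵥ fun j => (x j : ℝ)) i :=
      (Int.castRingHom ℝ).map_mulVec M x i
    rw [Pi.smul_apply, ← h2, h1]
    simp [hk']

/-! ### Flats of the truncated arrangement and the numbers `w_j`. -/

namespace TruncatedArrangement

open Classical

variable {l m n : ℕ} (𝒯 : TruncatedArrangement l m n)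

/-- Stated for an arbitrary map out of `ℤ`, to serve both over `ℝ` and modulo `q`. -/
theorem C_map_mulVec_eq_iff {R : Type} [CommRing R] (f : ℤ → R) (J : Finset (Fin m))
    (x : Fin n → R) (u : Fin l → R) (v : Fin m → R) :
    (𝒯.C J).map f *ᵥ x = Sum.elim u (fun i : J => v i) ↔
      𝒯.B.map f *ᵥ x = u ∧ ∀ i ∈ J, (𝒯.A.map f *ᵥ x) i = v i := by
  have h : (𝒯.C J).map f *ᵥ x =
      Sum.elim (𝒯.B.map f *ᵥ x) (fun i : J => (𝒯.A.map f *ᵥ x) i) := by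
    ext (i | i) <;> rfl
  rw [h, Sum.elim_eq_iff]
  refine and_congr Iff.rfl ?_
  rw [funext_iff, Subtype.forall]

theorem C_map_mulVec_eq_zero_iff {R : Type} [CommRing R] (f : ℤ → R) (J : Finset (Fin m))
    (x : Fin n → R) :
    (𝒯.C J).map f *ᵥ x = 0 ↔ 𝒯.B.map f *ᵥ x = 0 ∧ ∀ i ∈ J, (𝒯.A.map f *ᵥ x) i = 0 := by
  refine Iff.trans ?_ (𝒯.C_map_mulVec_eq_iff f J x 0 (fun _ => 0))
  have : (0 : Fin l ⊕ J → R) = Sum.elim (0 : Fin l → R) (fun _ : J => (0 : R)) := by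
    ext (i | i) <;> rfl
  rw [← this]

theorem mem_solSpace_C {J : Finset (Fin m)} {x : Fin n → ℝ} :
    x ∈ solSpace (𝒯.C J) (𝒯.c J) ↔ x ∈ 𝒯.V ∧ ∀ i ∈ J,
      (𝒯.A.map (Int.cast : ℤ → ℝ) *ᵥ x) i = 𝒯.a i := by
  have h : (fun i => ((𝒯.c J i : ℤ) : ℝ)) =
      Sum.elim (fun i => (𝒯.b i : ℝ)) (fun i : J => ((𝒯.a i : ℤ) : ℝ)) := by
    ext (i | i) <;> rfl
  rw [mem_solSpace, h]
  exact 𝒯.C_map_mulVec_eq_iff (Int.cast : ℤ → ℝ) J x (fun i => (𝒯.b i : ℝ))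
    (fun i => (𝒯.a i : ℝ))

theorem mem_H {i : Fin m} {x : Fin n → ℝ} :
    x ∈ 𝒯.H i ↔ (𝒯.A.map (Int.cast : ℤ → ℝ) *ᵥ x) i = 𝒯.a i ∧ x ∈ 𝒯.V := by
  rw [H, AffineSubspace.mem_inf_iff, mem_solSpace]
  refine and_congr ⟨fun h => congrFun h (), fun h => funext fun _ => h⟩ Iff.rfl

/-- The intersection of the hyperplanes with index in `J` inside `V`. -/
noncomputable def flat (J : Finset (Fin m)) : AffineSubspace ℝ (Fin n → ℝ) :=
  interIn 𝒯.V (J.image 𝒯.H)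

theorem flat_empty : 𝒯.flat ∅ = 𝒯.V := by
  rw [flat, Finset.image_empty, interIn_empty]

theorem flat_le (J : Finset (Fin m)) : 𝒯.flat J ≤ 𝒯.V := inf_le_left

theorem flat_anti {J K : Finset (Fin m)} (h : J ⊆ K) : 𝒯.flat K ≤ 𝒯.flat J :=
  interIn_mono (Finset.image_subset_image h)

theorem flat_le_H {J : Finset (Fin m)} {i : Fin m} (h : i ∈ J) : 𝒯.flat J ≤ 𝒯.H i :=
  interIn_le (Finset.mem_image_of_mem _ h)

theorem le_flat {W : AffineSubspace ℝ (Fin n → ℝ)} {J : Finset (Fin m)} (hV : W ≤ 𝒯.V)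
    (h : ∀ i ∈ J, W ≤ 𝒯.H i) : W ≤ 𝒯.flat J :=
  le_interIn hV fun K hK => by
    obtain ⟨i, hi, rfl⟩ := Finset.mem_image.mp hK
    exact h i hi

theorem flat_insert (i : Fin m) (J : Finset (Fin m)) :
    𝒯.flat (insert i J) = 𝒯.H i ⊓ 𝒯.flat J := by
  rw [flat, Finset.image_insert, interIn_insert, flat]

theorem flat_eq_solSpace (J : Finset (Fin m)) :
    𝒯.flat J = solSpace (𝒯.C J) (𝒯.c J) := by
  induction J using Finset.induction_on with
  | empty =>
    rw [flat_empty]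
    ext x
    rw [mem_solSpace_C]
    simp
  | insert i J _ ih =>
    rw [flat_insert, ih]
    ext x
    rw [AffineSubspace.mem_inf_iff, mem_solSpace_C, mem_solSpace_C, mem_H]
    simp only [Finset.mem_insert, forall_eq_or_imp]
    tauto

theorem flat_nonempty_iff (J : Finset (Fin m)) :
    (𝒯.flat J : Set (Fin n → ℝ)).Nonempty ↔ 𝒯.rBar J = 𝒯.r J := by
  rw [flat_eq_solSpace]
  exact solSpace_nonempty_iff _ _

theorem finrank_flat_add_r {J : Finset (Fin m)} (h : 𝒯.rBar J = 𝒯.r J) :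
    finrank ℝ (𝒯.flat J).direction + 𝒯.r J = n := by
  have h1 := (𝒯.flat_nonempty_iff J).mpr h
  rw [flat_eq_solSpace] at h1 ⊢
  rw [direction_solSpace h1]
  exact finrank_ker_add_intRank _

theorem mem_ker_C {J : Finset (Fin m)} {x : Fin n → ℝ} :
    x ∈ LinearMap.ker ((𝒯.C J).map (Int.cast : ℤ → ℝ)).mulVecLin ↔
      𝒯.B.map (Int.cast : ℤ → ℝ) *ᵥ x = 0 ∧
        ∀ i ∈ J, (𝒯.A.map (Int.cast : ℤ → ℝ) *ᵥ x) i = 0 := by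
  rw [LinearMap.mem_ker, Matrix.mulVecLin_apply, C_map_mulVec_eq_zero_iff]

theorem r_le_of_ker_le {J K : Finset (Fin m)}
    (h : LinearMap.ker ((𝒯.C K).map (Int.cast : ℤ → ℝ)).mulVecLin ≤
      LinearMap.ker ((𝒯.C J).map (Int.cast : ℤ → ℝ)).mulVecLin) : 𝒯.r J ≤ 𝒯.r K := by
  have h1 := Submodule.finrank_mono h
  have h2 := finrank_ker_add_intRank (𝒯.C J)
  have h3 := finrank_ker_add_intRank (𝒯.C K)
  rw [r, r]
  omega

theorem r_mono {J K : Finset (Fin m)} (h : J ⊆ K) : 𝒯.r J ≤ 𝒯.r K := by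
  refine 𝒯.r_le_of_ker_le fun x hx => ?_
  rw [mem_ker_C] at hx ⊢
  exact ⟨hx.1, fun i hi => hx.2 i (h hi)⟩

theorem r_le (J : Finset (Fin m)) : 𝒯.r J ≤ n := by
  have := finrank_ker_add_intRank (𝒯.C J)
  rw [r]
  omega

variable {𝒯}

theorem rBar_empty (hV : (𝒯.V : Set (Fin n → ℝ)).Nonempty) : 𝒯.rBar ∅ = 𝒯.r ∅ := by
  rwa [← flat_nonempty_iff, flat_empty]

/-- If `r(J)` is not yet maximal, some direction `v` of the flat of `J` is not annihilated by a row
`i` of `A`. Moving along `v` reaches `H_i`, so adding `i` keeps consistency and raises the rank, by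
exactly one since `H_i` has codimension one. -/
theorem exists_central (hV : (𝒯.V : Set (Fin n → ℝ)).Nonempty)
    (hH : ∀ i : Fin m, IsCodimOne (𝒯.H i) 𝒯.V) (j : ℕ) (hj : 𝒯.r ∅ ≤ j)
    (hj' : j ≤ 𝒯.r Finset.univ) : ∃ J, 𝒯.rBar J = 𝒯.r J ∧ 𝒯.r J = j := by
  induction j, hj using Nat.le_induction with
  | base => exact ⟨∅, rBar_empty hV, rfl⟩
  | succ j _ ih =>
    obtain ⟨J, hJ, hJj⟩ := ih (by omega)
    have hnot : ¬ LinearMap.ker ((𝒯.C J).map (Int.cast : ℤ → ℝ)).mulVecLin ≤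
        LinearMap.ker ((𝒯.C Finset.univ).map (Int.cast : ℤ → ℝ)).mulVecLin := by
      intro h
      have := 𝒯.r_le_of_ker_le h
      omega
    obtain ⟨v, hv, hv'⟩ := SetLike.not_le_iff_exists.mp hnot
    rw [mem_ker_C] at hv hv'
    obtain ⟨i, hi⟩ : ∃ i, (𝒯.A.map (Int.cast : ℤ → ℝ) *ᵥ v) i ≠ 0 := by
      by_contra! hcon
      exact hv' ⟨hv.1, fun i _ => hcon i⟩
    obtain ⟨x, hx⟩ := (𝒯.flat_nonempty_iff J).mpr hJ
    have hx' := hx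
    rw [SetLike.mem_coe, flat_eq_solSpace, mem_solSpace_C] at hx'
    have hne : (𝒯.flat (insert i J) : Set (Fin n → ℝ)).Nonempty := by
      -- The parameter at which the line `x + t v` meets the hyperplane `i`.
      set t : ℝ := (𝒯.a i - (𝒯.A.map (Int.cast : ℤ → ℝ) *ᵥ x) i) /
        (𝒯.A.map (Int.cast : ℤ → ℝ) *ᵥ v) i with ht
      refine ⟨x + t • v, ?_⟩
      rw [SetLike.mem_coe, flat_eq_solSpace, mem_solSpace_C]
      refine ⟨?_, ?_⟩
      · have h1 := hx'.1
        rw [V, mem_solSpace] at h1 ⊢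
        rw [Matrix.mulVec_add, Matrix.mulVec_smul, hv.1, smul_zero, add_zero, h1]
      · intro i' hi'
        rw [Matrix.mulVec_add, Matrix.mulVec_smul, Pi.add_apply, Pi.smul_apply, smul_eq_mul]
        rcases Finset.mem_insert.mp hi' with rfl | hi'
        · rw [ht, div_mul_cancel₀ _ hi]
          ring
        · rw [hv.2 i' hi', mul_zero, add_zero, hx'.2 i' hi']
    have hcen := (𝒯.flat_nonempty_iff _).mp hne
    refine ⟨insert i J, hcen, ?_⟩
    have h1 := 𝒯.finrank_flat_add_r hJ
    have h2 := 𝒯.finrank_flat_add_r hcen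
    have h3 : finrank ℝ (𝒯.flat J).direction ≤
        finrank ℝ (𝒯.flat (insert i J)).direction + 1 := by
      rw [flat_insert] at hne ⊢
      exact finrank_direction_le_of_isCodimOne (hH i) (𝒯.flat_le J) hne
    -- Equal ranks would put the whole flat, in particular `x` and `x + v`, into `H_i`, although the
    -- `i`-th form differs on them.
    have h4 : 𝒯.r J < 𝒯.r (insert i J) := by
      refine lt_of_le_of_ne (𝒯.r_mono (Finset.subset_insert _ _)) fun heq => ?_
      have h5 : 𝒯.flat (insert i J) = 𝒯.flat J := affineSubspace_eq_of_le_of_finrank_le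
        (𝒯.flat_anti (Finset.subset_insert _ _)) hne (by omega)
      have h6 : x + v ∈ 𝒯.flat J := by
        rw [flat_eq_solSpace, mem_solSpace_C]
        refine ⟨?_, fun i' hi' => ?_⟩
        · have h1 := hx'.1
          rw [V, mem_solSpace] at h1 ⊢
          rw [Matrix.mulVec_add, hv.1, add_zero, h1]
        · rw [Matrix.mulVec_add, Pi.add_apply, hv.2 i' hi', add_zero, hx'.2 i' hi']
      have h7 : x ∈ 𝒯.flat (insert i J) := h5 ▸ hx
      rw [← h5] at h6
      have h8 := (𝒯.mem_H.mp (𝒯.flat_le_H (Finset.mem_insert_self i J) h6)).1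
      have h9 := (𝒯.mem_H.mp (𝒯.flat_le_H (Finset.mem_insert_self i J) h7)).1
      rw [Matrix.mulVec_add, Pi.add_apply, h9] at h8
      exact hi (by linarith)
    omega

/-- The consistent index sets of rank `j` that are contained in `Z`. -/
noncomputable def centralSets (𝒯 : TruncatedArrangement l m n) (Z : Finset (Fin m)) (j : ℕ) :
    Finset (Finset (Fin m)) :=
  Z.powerset.filter fun J => 𝒯.rBar J = 𝒯.r J ∧ 𝒯.r J = j

theorem mem_centralSets {Z J : Finset (Fin m)} {j : ℕ} :
    J ∈ 𝒯.centralSets Z j ↔ J ⊆ Z ∧ 𝒯.rBar J = 𝒯.r J ∧ 𝒯.r J = j := by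
  rw [centralSets, Finset.mem_filter, Finset.mem_powerset]

/-- Different indices may define the same hyperplane; `sum_image_eq` absorbs these multiplicities.
The set `Z` is arbitrary, because the inequality needs the result for all subarrangements. -/
theorem sum_centralSets
    {prec : AffineSubspace ℝ (Fin n → ℝ) → AffineSubspace ℝ (Fin n → ℝ) → Prop}
    (hV : (𝒯.V : Set (Fin n → ℝ)).Nonempty)
    (hH : ∀ i : Fin m, IsCodimOne (𝒯.H i) 𝒯.V)
    (hprec : IsStrictTotalOrder (AffineSubspace ℝ (Fin n → ℝ)) prec)
    (Z : Finset (Fin m)) {j : ℕ} (hj : 𝒯.r ∅ ≤ j) :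
    ∑ J ∈ 𝒯.centralSets Z j, (-1 : ℤ) ^ J.card =
      (-1) ^ (j - 𝒯.r ∅) * nbcCount prec 𝒯.V (Z.image 𝒯.H) (j - 𝒯.r ∅) := by
  have hcodim : ∀ H ∈ Z.image 𝒯.H, IsCodimOne H 𝒯.V := by
    intro H hH'
    obtain ⟨i, _, rfl⟩ := Finset.mem_image.mp hH'
    exact hH i
  have hiff : ∀ J : Finset (Fin m), (IsCentralIn 𝒯.V (J.image 𝒯.H) ∧
      finrank ℝ (interIn 𝒯.V (J.image 𝒯.H)).direction + (j - 𝒯.r ∅) =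
        finrank ℝ 𝒯.V.direction) ↔ 𝒯.rBar J = 𝒯.r J ∧ 𝒯.r J = j := by
    intro J
    rw [← 𝒯.flat_nonempty_iff J]
    refine and_congr_right fun hJ => ?_
    have h1 := 𝒯.finrank_flat_add_r ((𝒯.flat_nonempty_iff J).mp hJ)
    have h2 := 𝒯.finrank_flat_add_r (rBar_empty hV)
    rw [flat_empty] at h2
    have h3 := 𝒯.r_mono (Finset.empty_subset J)
    rw [flat] at h1
    omega
  rw [← sum_centralOfCodim hprec hcodim]
  rw [← Finset.sum_fiberwise_of_maps_to (t := centralOfCodim 𝒯.V (Z.image 𝒯.H) (j - 𝒯.r ∅))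
    (g := fun J => J.image 𝒯.H)]
  · refine Finset.sum_congr rfl fun S hS => ?_
    rw [centralOfCodim, Finset.mem_filter, Finset.mem_powerset] at hS
    rw [← sum_image_eq 𝒯.H Z S hS.1]
    refine Finset.sum_congr (Finset.ext fun J => ?_) fun _ _ => rfl
    rw [Finset.mem_filter, Finset.mem_filter, mem_centralSets, Finset.mem_powerset]
    constructor
    · rintro ⟨⟨h1, -⟩, h2⟩
      exact ⟨h1, h2⟩
    · rintro ⟨h1, rfl⟩
      exact ⟨⟨h1, (hiff J).mp hS.2⟩, rfl⟩
  · intro J hJ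
    rw [mem_centralSets] at hJ
    rw [centralOfCodim, Finset.mem_filter, Finset.mem_powerset]
    exact ⟨Finset.image_subset_image hJ.1, (hiff J).mpr hJ.2⟩

theorem sign_mul_sum_centralSets_nonneg
    (hV : (𝒯.V : Set (Fin n → ℝ)).Nonempty)
    (hH : ∀ i : Fin m, IsCodimOne (𝒯.H i) 𝒯.V)
    {prec : AffineSubspace ℝ (Fin n → ℝ) → AffineSubspace ℝ (Fin n → ℝ) → Prop}
    (hprec : IsStrictTotalOrder (AffineSubspace ℝ (Fin n → ℝ)) prec)
    (Z : Finset (Fin m)) {j : ℕ} (hj : 𝒯.r ∅ ≤ j) :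
    0 ≤ (-1) ^ (j - 𝒯.r ∅) * ∑ J ∈ 𝒯.centralSets Z j, (-1 : ℤ) ^ J.card := by
  rw [sum_centralSets hV hH hprec Z hj, ← mul_assoc, ← mul_pow]
  simp

theorem w_eq
    {prec : AffineSubspace ℝ (Fin n → ℝ) → AffineSubspace ℝ (Fin n → ℝ) → Prop}
    (hV : (𝒯.V : Set (Fin n → ℝ)).Nonempty)
    (hH : ∀ i : Fin m, IsCodimOne (𝒯.H i) 𝒯.V)
    (hprec : IsStrictTotalOrder (AffineSubspace ℝ (Fin n → ℝ)) prec)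
    {j : ℕ} (hj : 𝒯.r ∅ ≤ j) :
    (𝒯.w prec j : ℤ) =
      (-1) ^ (j - 𝒯.r ∅) * ∑ J ∈ 𝒯.centralSets Finset.univ j, (-1 : ℤ) ^ J.card := by
  rw [sum_centralSets hV hH hprec Finset.univ hj, ← mul_assoc, ← mul_pow]
  simp [w, arr]

theorem w_pos
    {prec : AffineSubspace ℝ (Fin n → ℝ) → AffineSubspace ℝ (Fin n → ℝ) → Prop}
    (hV : (𝒯.V : Set (Fin n → ℝ)).Nonempty)
    (hH : ∀ i : Fin m, IsCodimOne (𝒯.H i) 𝒯.V)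
    (hprec : IsStrictTotalOrder (AffineSubspace ℝ (Fin n → ℝ)) prec)
    {j : ℕ} (hj : 𝒯.r ∅ ≤ j) (hj' : j ≤ 𝒯.r Finset.univ) : 0 < 𝒯.w prec j := by
  obtain ⟨J, hJ, hJj⟩ := exists_central hV hH j hj hj'
  refine nbcCount_pos (S := J.image 𝒯.H) hprec ?_ (Finset.image_subset_image (by simp))
    ((𝒯.flat_nonempty_iff J).mpr hJ) ?_
  · intro H hH'
    obtain ⟨i, _, rfl⟩ := Finset.mem_image.mp hH'
    exact hH i
  · have h1 := 𝒯.finrank_flat_add_r hJ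
    have h2 := 𝒯.finrank_flat_add_r (rBar_empty hV)
    rw [flat_empty] at h2
    rw [flat] at h1
    omega

end TruncatedArrangement

/-! ### Inclusion and exclusion modulo `q`. -/

namespace TruncatedArrangement

open Classical

variable {l m n : ℕ} {𝒯 : TruncatedArrangement l m n}

theorem sum_neg_one_pow_mul_card {α : Type} (𝒥 : Finset (Finset (Fin m))) (X : Finset α)
    (Z : α → Finset (Fin m)) :
    ∑ J ∈ 𝒥, (-1 : ℤ) ^ J.card * ((X.filter fun x => J ⊆ Z x).card : ℤ) =
      ∑ x ∈ X, ∑ J ∈ 𝒥.filter (fun J => J ⊆ Z x), (-1 : ℤ) ^ J.card := by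
  simp only [Finset.card_filter, Nat.cast_sum, Finset.mul_sum, Finset.sum_filter]
  rw [Finset.sum_comm]
  refine Finset.sum_congr rfl fun x _ => Finset.sum_congr rfl fun J _ => ?_
  split_ifs <;> simp

theorem matMod_C_mulVec_eq_iff (𝒯 : TruncatedArrangement l m n) (q : ℕ) (J : Finset (Fin m)) (x : Fin n → ZMod q) :
    matMod q (𝒯.C J) *ᵥ x = vecMod q (𝒯.c J) ↔ matMod q 𝒯.B *ᵥ x = vecMod q 𝒯.b ∧
      ∀ i ∈ J, (matMod q 𝒯.A *ᵥ x) i = vecMod q 𝒯.a i := by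
  refine Iff.trans ?_ (𝒯.C_map_mulVec_eq_iff (Int.cast : ℤ → ZMod q) J x (vecMod q 𝒯.b)
    (vecMod q 𝒯.a))
  have : vecMod q (𝒯.c J) = Sum.elim (vecMod q 𝒯.b) (fun i : J => vecMod q 𝒯.a i) := by
    ext (i | i) <;> rfl
  rw [← this]
  rfl

section Modular

variable (𝒯) (q : ℕ) [NeZero q]

theorem card_solutions_eq (J : Finset (Fin m)) :
    Nat.card {x : Fin n → ZMod q // matMod q (𝒯.C J) *ᵥ x = vecMod q (𝒯.c J)} =
      ((Finset.univ.filter fun x : Fin n → ZMod q => matMod q 𝒯.B *ᵥ x = vecMod q 𝒯.b).filter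
        fun x => J ⊆ Finset.univ.filter fun i =>
          (matMod q 𝒯.A *ᵥ x) i = vecMod q 𝒯.a i).card := by
  rw [Nat.card_eq_fintype_card, Fintype.card_subtype, Finset.filter_filter]
  congr 1
  ext x
  simp [matMod_C_mulVec_eq_iff, Finset.subset_iff]

theorem kerCount_C_eq (J : Finset (Fin m)) :
    kerCount q (𝒯.C J) =
      ((Finset.univ.filter fun x : Fin n → ZMod q => matMod q 𝒯.B *ᵥ x = 0).filter
        fun x => J ⊆ Finset.univ.filter fun i => (matMod q 𝒯.A *ᵥ x) i = 0).card := by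
  rw [kerCount, Nat.card_eq_fintype_card, Fintype.card_subtype, Finset.filter_filter]
  congr 1
  ext x
  have := 𝒯.C_map_mulVec_eq_zero_iff (Int.cast : ℤ → ZMod q) J x
  simp only [Finset.mem_filter, Finset.mem_univ, true_and, Finset.subset_iff]
  exact this

/-- Inclusion and exclusion for the points of the complement modulo `q`. -/
theorem ncard_complMod :
    ((𝒯.complMod q).ncard : ℤ) = ∑ J : Finset (Fin m), (-1 : ℤ) ^ J.card *
      (Nat.card {x : Fin n → ZMod q // matMod q (𝒯.C J) *ᵥ x = vecMod q (𝒯.c J)} : ℤ) := by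
  simp only [card_solutions_eq]
  rw [sum_neg_one_pow_mul_card]
  have h1 : ∀ Y : Finset (Fin m), (Finset.univ.filter fun J : Finset (Fin m) => J ⊆ Y) =
      Y.powerset := fun Y => by ext J; simp
  simp only [h1, Finset.sum_powerset_neg_one_pow_card]
  rw [← Finset.sum_filter, Finset.sum_const, nsmul_one, Finset.filter_filter,
    ← Set.ncard_coe_finset]
  congr 2
  ext x
  simp [complMod, Finset.filter_eq_empty_iff]

theorem hasSmithForm_C (J : Finset (Fin m)) :
    HasSmithForm (𝒯.C J) (𝒯.r J) (invFactor (𝒯.C J)) := hasSmithForm_invFactor _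

theorem hasSmithForm_CBar (J : Finset (Fin m)) :
    HasSmithForm (𝒯.CBar J) (𝒯.rBar J) (invFactor (𝒯.CBar J)) := hasSmithForm_invFactor _

theorem r_le_rBar (J : Finset (Fin m)) : 𝒯.r J ≤ 𝒯.rBar J := intRank_le_fromCols _ _

theorem rBar_le (J : Finset (Fin m)) : 𝒯.rBar J ≤ 𝒯.r J + 1 := intRank_fromCols_le _ _

theorem mem_colSpaceMod_C_iff (J : Finset (Fin m)) :
    vecMod q (𝒯.c J) ∈ colSpaceMod q (𝒯.C J) ↔
      ∀ j < 𝒯.rBar J, q.gcd (invFactor (𝒯.C J) j) = q.gcd (invFactor (𝒯.CBar J) j) :=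
  mem_colSpaceMod_iff_gcd (𝒯.hasSmithForm_C J) (𝒯.hasSmithForm_CBar J) (𝒯.r_le_rBar J) q

theorem dTilde_eq {q : ℕ} [NeZero q] {J : Finset (Fin m)}
    (h : vecMod q (𝒯.c J) ∈ colSpaceMod q (𝒯.C J)) :
    𝒯.dTilde J q = ∏ j ∈ Finset.range (𝒯.r J), (invFactor (𝒯.C J) j).gcd q := by
  rw [dTilde, if_pos ((𝒯.mem_colSpaceMod_C_iff q J).mp h)]

theorem dTilde_one (J : Finset (Fin m)) : 𝒯.dTilde J 1 = 1 := by
  simp [dTilde]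

theorem dTilde_mul_pow {q : ℕ} [NeZero q] {J : Finset (Fin m)}
    (h : vecMod q (𝒯.c J) ∈ colSpaceMod q (𝒯.C J)) :
    𝒯.dTilde J q * q ^ (n - 𝒯.r J) = kerCount q (𝒯.C J) := by
  rw [dTilde_eq 𝒯 h, (𝒯.hasSmithForm_C J).kerCount_eq_mul_pow, Fintype.card_fin]

theorem pow_le_kerCount (J : Finset (Fin m)) : q ^ (n - 𝒯.r J) ≤ kerCount q (𝒯.C J) := by
  rw [(𝒯.hasSmithForm_C J).kerCount_eq_mul_pow, Fintype.card_fin]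
  refine Nat.le_mul_of_pos_left _ (Finset.prod_pos fun j _ => ?_)
  exact Nat.gcd_pos_of_pos_right _ (NeZero.pos q)

theorem card_solutions_of_mem {J : Finset (Fin m)}
    (h : vecMod q (𝒯.c J) ∈ colSpaceMod q (𝒯.C J)) :
    Nat.card {x : Fin n → ZMod q // matMod q (𝒯.C J) *ᵥ x = vecMod q (𝒯.c J)} =
      𝒯.dTilde J q * q ^ (n - 𝒯.r J) := by
  rw [card_solutions q _ _ h, dTilde_mul_pow 𝒯 h]

/-- An inconsistent subsystem has no solutions modulo any `q > q₀`. -/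
theorem card_solutions_of_ne {J : Finset (Fin m)} (hJ : 𝒯.rBar J ≠ 𝒯.r J) (hq : 𝒯.q0 < q) :
    Nat.card {x : Fin n → ZMod q // matMod q (𝒯.C J) *ᵥ x = vecMod q (𝒯.c J)} = 0 := by
  rw [Nat.card_eq_zero]
  refine Or.inl ⟨fun x => ?_⟩
  have hmem := (mem_colSpaceMod_iff_exists q _ _).mpr ⟨x.1, x.2⟩
  rw [mem_colSpaceMod_C_iff] at hmem
  have hr : 𝒯.rBar J = 𝒯.r J + 1 := by
    have h1 := 𝒯.r_le_rBar J
    have h2 := 𝒯.rBar_le J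
    omega
  -- At this index the factor of `C_J` is `0`, so `q` divides the last, positive invariant factor of
  -- the augmented matrix, which is at most `q₀`.
  have h3 := hmem (𝒯.r J) (by omega)
  rw [(𝒯.hasSmithForm_C J).2.1 _ le_rfl, Nat.gcd_zero_right] at h3
  have h4 : q ∣ invFactor (𝒯.CBar J) (𝒯.r J) := Nat.gcd_eq_left_iff_dvd.mp h3.symm
  have h5 := Nat.le_of_dvd ((𝒯.hasSmithForm_CBar J).1 _ (by omega)) h4
  have h6 : maxInvFactor (𝒯.CBar J) = invFactor (𝒯.CBar J) (𝒯.r J) := by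
    have h7 : intRank (𝒯.CBar J) = 𝒯.r J + 1 := hr
    rw [maxInvFactor, h7, if_neg (by omega), Nat.add_sub_cancel]
  have h8 : maxInvFactor (𝒯.CBar J) ≤ 𝒯.q0 :=
    Finset.le_sup (f := fun J => maxInvFactor (𝒯.CBar J)) (by simp [hr])
  omega

end Modular

/-! ### Grouping index sets by flats. -/

/-- The hyperplanes that contain the flat of `J`. -/
noncomputable def closure (𝒯 : TruncatedArrangement l m n) (J : Finset (Fin m)) :
    Finset (Fin m) :=
  Finset.univ.filter fun i => 𝒯.flat J ≤ 𝒯.H i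

theorem subset_closure (J : Finset (Fin m)) : J ⊆ 𝒯.closure J := fun i hi => by
  simpa [closure] using 𝒯.flat_le_H hi

theorem flat_closure (J : Finset (Fin m)) : 𝒯.flat (𝒯.closure J) = 𝒯.flat J :=
  le_antisymm (𝒯.flat_anti (subset_closure J))
    (𝒯.le_flat (𝒯.flat_le J) fun i hi => by simpa [closure] using hi)

theorem closure_mem {J : Finset (Fin m)} {j : ℕ} (hJ : J ∈ 𝒯.centralSets Finset.univ j) :
    𝒯.closure J ∈ 𝒯.centralSets Finset.univ j := by
  rw [mem_centralSets] at hJ ⊢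
  have h1 : 𝒯.rBar (𝒯.closure J) = 𝒯.r (𝒯.closure J) := by
    rw [← flat_nonempty_iff, flat_closure, flat_nonempty_iff]
    exact hJ.2.1
  refine ⟨Finset.subset_univ _, h1, ?_⟩
  have h2 := 𝒯.finrank_flat_add_r h1
  have h3 := 𝒯.finrank_flat_add_r hJ.2.1
  rw [flat_closure] at h2
  omega

/-- A consistent set of rank `j` inside the closure of `J₀` has a flat that contains the flat of
`J₀` and has the same dimension, so the flats are equal. -/
theorem filter_closure_eq {J₀ : Finset (Fin m)} {j : ℕ}
    (hJ₀ : J₀ ∈ 𝒯.centralSets Finset.univ j) :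
    (𝒯.centralSets Finset.univ j).filter (fun J => 𝒯.closure J = 𝒯.closure J₀) =
      𝒯.centralSets (𝒯.closure J₀) j := by
  ext J
  rw [Finset.mem_filter, mem_centralSets, mem_centralSets]
  constructor
  · rintro ⟨⟨-, h⟩, hcl⟩
    exact ⟨hcl ▸ subset_closure J, h⟩
  · rintro ⟨hsub, h⟩
    refine ⟨⟨Finset.subset_univ _, h⟩, ?_⟩
    rw [mem_centralSets] at hJ₀
    have h1 : 𝒯.flat J₀ ≤ 𝒯.flat J := flat_closure (𝒯 := 𝒯) J₀ ▸ 𝒯.flat_anti hsub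
    have h2 : 𝒯.flat J₀ = 𝒯.flat J := by
      refine affineSubspace_eq_of_le_of_finrank_le h1
        ((𝒯.flat_nonempty_iff J₀).mpr hJ₀.2.1) ?_
      have h3 := 𝒯.finrank_flat_add_r h.1
      have h4 := 𝒯.finrank_flat_add_r hJ₀.2.1
      omega
    rw [closure, closure, h2]

theorem sum_eq_sum_flats (f : Finset (Fin m) → ℤ) (j : ℕ) :
    ∑ J ∈ 𝒯.centralSets Finset.univ j, f J =
      ∑ Z ∈ (𝒯.centralSets Finset.univ j).image 𝒯.closure, ∑ J ∈ 𝒯.centralSets Z j, f J := by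
  rw [← Finset.sum_fiberwise_of_maps_to (t := (𝒯.centralSets Finset.univ j).image 𝒯.closure)
    (g := 𝒯.closure) fun J hJ => Finset.mem_image_of_mem _ hJ]
  refine Finset.sum_congr rfl fun Z hZ => ?_
  obtain ⟨J₀, hJ₀, rfl⟩ := Finset.mem_image.mp hZ
  rw [filter_closure_eq hJ₀]

theorem filter_subset_centralSets (Z Y : Finset (Fin m)) (j : ℕ) :
    (𝒯.centralSets Z j).filter (fun J => J ⊆ Y) = 𝒯.centralSets (Z ∩ Y) j := by
  ext J
  rw [Finset.mem_filter, mem_centralSets, mem_centralSets, Finset.subset_inter_iff]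
  tauto

/-! ### The inequality between the coefficients. -/

section Inequality

variable {prec : AffineSubspace ℝ (Fin n → ℝ) → AffineSubspace ℝ (Fin n → ℝ) → Prop}

/-- With the sum over points outside, the point `x` contributes the signed count for `Z ∩ Y x`,
which is nonnegative by Whitney's theorem. The points with `Z ⊆ Y x`, at least `q^(n-j)` in number,
contribute the full count, and the others are dropped. -/
theorem pow_mul_sum_le_sum_kerCount (hV : (𝒯.V : Set (Fin n → ℝ)).Nonempty)
    (hH : ∀ i : Fin m, IsCodimOne (𝒯.H i) 𝒯.V)
    (hprec : IsStrictTotalOrder (AffineSubspace ℝ (Fin n → ℝ)) prec)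
    (q : ℕ) [NeZero q] {j : ℕ} (hj : 𝒯.r ∅ ≤ j) {Z : Finset (Fin m)} (hZ : 𝒯.r Z = j) :
    (q : ℤ) ^ (n - j) * ((-1) ^ (j - 𝒯.r ∅) * ∑ J ∈ 𝒯.centralSets Z j, (-1 : ℤ) ^ J.card) ≤
      (-1) ^ (j - 𝒯.r ∅) * ∑ J ∈ 𝒯.centralSets Z j, (-1 : ℤ) ^ J.card *
        (kerCount q (𝒯.C J) : ℤ) := by
  have hker := 𝒯.pow_le_kerCount q Z
  rw [kerCount_C_eq, hZ] at hker
  simp only [kerCount_C_eq]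
  rw [sum_neg_one_pow_mul_card]
  simp only [filter_subset_centralSets]
  set X := Finset.univ.filter fun x : Fin n → ZMod q => matMod q 𝒯.B *ᵥ x = 0
  set Y : (Fin n → ZMod q) → Finset (Fin m) := fun x =>
    Finset.univ.filter fun i => (matMod q 𝒯.A *ᵥ x) i = 0
  rw [Finset.mul_sum X]
  calc (q : ℤ) ^ (n - j) *
        ((-1) ^ (j - 𝒯.r ∅) * ∑ J ∈ 𝒯.centralSets Z j, (-1 : ℤ) ^ J.card)
      ≤ ((X.filter fun x => Z ⊆ Y x).card : ℤ) *
        ((-1) ^ (j - 𝒯.r ∅) * ∑ J ∈ 𝒯.centralSets Z j, (-1 : ℤ) ^ J.card) :=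
        mul_le_mul_of_nonneg_right (by exact_mod_cast hker)
          (sign_mul_sum_centralSets_nonneg hV hH hprec Z hj)
    _ = ∑ x ∈ X.filter fun x => Z ⊆ Y x,
        (-1) ^ (j - 𝒯.r ∅) * ∑ J ∈ 𝒯.centralSets (Z ∩ Y x) j, (-1 : ℤ) ^ J.card := by
        rw [← nsmul_eq_mul, ← Finset.sum_const]
        refine Finset.sum_congr rfl fun x hx => ?_
        rw [Finset.inter_eq_left.mpr (Finset.mem_filter.mp hx).2]
    _ ≤ _ := Finset.sum_le_sum_of_subset_of_nonneg (Finset.filter_subset _ _)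
        fun x _ _ => sign_mul_sum_centralSets_nonneg hV hH hprec _ hj

theorem filter_eq_centralSets (j : ℕ) :
    (Finset.univ.filter fun J : Finset (Fin m) => 𝒯.rBar J = 𝒯.r J ∧ 𝒯.r J = j) =
      𝒯.centralSets Finset.univ j := by
  ext J
  simp [mem_centralSets]

theorem beta_eq (j q : ℕ) : 𝒯.beta j q = (-1) ^ (j - 𝒯.r ∅) *
    ∑ J ∈ 𝒯.centralSets Finset.univ j, (-1) ^ J.card * (𝒯.dTilde J q : ℤ) := by
  rw [beta, filter_eq_centralSets]

theorem gamma_eq_beta (j k : ℕ) : 𝒯.gamma j k = 𝒯.beta j k := rfl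

theorem w_eq_gamma_one (hV : (𝒯.V : Set (Fin n → ℝ)).Nonempty)
    (hH : ∀ i : Fin m, IsCodimOne (𝒯.H i) 𝒯.V)
    (hprec : IsStrictTotalOrder (AffineSubspace ℝ (Fin n → ℝ)) prec)
    {j : ℕ} (hj : 𝒯.r ∅ ≤ j) : (𝒯.w prec j : ℤ) = 𝒯.gamma j 1 := by
  rw [w_eq hV hH hprec hj, gamma_eq_beta, beta_eq]
  simp [dTilde_one]

theorem gamma_one_le_beta (hV : (𝒯.V : Set (Fin n → ℝ)).Nonempty)
    (hH : ∀ i : Fin m, IsCodimOne (𝒯.H i) 𝒯.V)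
    (hprec : IsStrictTotalOrder (AffineSubspace ℝ (Fin n → ℝ)) prec)
    {q : ℕ} [NeZero q]
    -- Solvability ensures that no `d̃_J(q)` is replaced by `0`; after scaling by `q^(n-j)` the
    -- terms become kernel counts, and the comparison is made flat by flat.
    (hsol : ∀ J, 𝒯.rBar J = 𝒯.r J → vecMod q (𝒯.c J) ∈ colSpaceMod q (𝒯.C J))
    {j : ℕ} (hj : 𝒯.r ∅ ≤ j) : 𝒯.gamma j 1 ≤ 𝒯.beta j q := by
  have hq : (0 : ℤ) < (q : ℤ) ^ (n - j) := pow_pos (by exact_mod_cast NeZero.pos q) _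
  refine le_of_mul_le_mul_left ?_ hq
  rw [← w_eq_gamma_one hV hH hprec hj, w_eq hV hH hprec hj, beta_eq]
  have h1 : (q : ℤ) ^ (n - j) * ((-1) ^ (j - 𝒯.r ∅) *
      ∑ J ∈ 𝒯.centralSets Finset.univ j, (-1) ^ J.card * (𝒯.dTilde J q : ℤ)) =
      (-1) ^ (j - 𝒯.r ∅) * ∑ J ∈ 𝒯.centralSets Finset.univ j, (-1 : ℤ) ^ J.card *
        (kerCount q (𝒯.C J) : ℤ) := by
    rw [mul_left_comm, Finset.mul_sum]
    congr 1
    refine Finset.sum_congr rfl fun J hJ => ?_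
    rw [mem_centralSets] at hJ
    rw [← dTilde_mul_pow 𝒯 (hsol J hJ.2.1), hJ.2.2]
    push_cast
    ring
  rw [h1, sum_eq_sum_flats, sum_eq_sum_flats, Finset.mul_sum, Finset.mul_sum, Finset.mul_sum]
  refine Finset.sum_le_sum fun Z hZ => ?_
  obtain ⟨J₀, hJ₀, rfl⟩ := Finset.mem_image.mp hZ
  exact pow_mul_sum_le_sum_kerCount hV hH hprec q hj (mem_centralSets.mp (closure_mem hJ₀)).2.2

end Inequality

/-! ### The constituents of the quasi-polynomial. -/

section Constituent

theorem invFactor_dvd_maxInvFactor {ι κ : Type} [Fintype ι] [DecidableEq ι] [Fintype κ]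
    [DecidableEq κ] (M : Matrix ι κ ℤ) {j : ℕ} (hj : j < intRank M) :
    invFactor M j ∣ maxInvFactor M := by
  rw [maxInvFactor, if_neg (by omega)]
  obtain ⟨t, ht⟩ : ∃ t, intRank M - 1 = j + t := ⟨intRank M - 1 - j, by omega⟩
  rw [ht]
  clear ht
  induction t with
  | zero => exact dvd_rfl
  | succ t ih => exact ih.trans ((hasSmithForm_invFactor M).2.2.1 _)

theorem invFactor_dvd_rho {J : Finset (Fin m)} (hJ : 𝒯.rBar J = 𝒯.r J) {j : ℕ}
    (hj : j < 𝒯.r J) : invFactor (𝒯.C J) j ∣ 𝒯.rho :=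
  (invFactor_dvd_maxInvFactor _ hj).trans
    (Finset.dvd_lcm (f := fun J => maxInvFactor (𝒯.C J)) (by simp [hJ]))

theorem solvable_of_gcd_eq {q k : ℕ} (hq : 0 < q) (hqk : q.gcd 𝒯.rho = k.gcd 𝒯.rho)
    {J : Finset (Fin m)} (hJ : 𝒯.rBar J = 𝒯.r J)
    (h : vecMod q (𝒯.c J) ∈ colSpaceMod q (𝒯.C J)) :
    vecMod k (𝒯.c J) ∈ colSpaceMod k (𝒯.C J) :=
  mem_colSpaceMod_of_gcd_eq (𝒯.hasSmithForm_C J) (fun _ hj => invFactor_dvd_rho hJ hj) hJ hq hqk h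

theorem dTilde_eq_of_gcd_eq {q k : ℕ} [NeZero q] [NeZero k]
    (hqk : q.gcd 𝒯.rho = k.gcd 𝒯.rho) {J : Finset (Fin m)} (hJ : 𝒯.rBar J = 𝒯.r J)
    (h : vecMod q (𝒯.c J) ∈ colSpaceMod q (𝒯.C J)) : 𝒯.dTilde J q = 𝒯.dTilde J k := by
  rw [dTilde_eq 𝒯 h, dTilde_eq 𝒯 (solvable_of_gcd_eq (NeZero.pos q) hqk hJ h)]
  refine Finset.prod_congr rfl fun j hj => ?_
  have hd := invFactor_dvd_rho hJ (Finset.mem_range.mp hj)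
  -- Since `d_j` divides `ρ_C`, its gcd with `q` is its gcd with `gcd(ρ_C, q)`.
  rw [← Nat.gcd_eq_left hd, Nat.gcd_assoc, Nat.gcd_assoc, Nat.gcd_comm _ q, Nat.gcd_comm _ k, hqk]

theorem beta_eq_of_gcd_eq {q k : ℕ} [NeZero q] [NeZero k]
    (hqk : q.gcd 𝒯.rho = k.gcd 𝒯.rho)
    (hsol : ∀ J, 𝒯.rBar J = 𝒯.r J → vecMod q (𝒯.c J) ∈ colSpaceMod q (𝒯.C J)) (j : ℕ) :
    𝒯.beta j q = 𝒯.beta j k := by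
  rw [beta_eq, beta_eq]
  congr 1
  refine Finset.sum_congr rfl fun J hJ => ?_
  have hJ' := (mem_centralSets.mp hJ).2.1
  rw [dTilde_eq_of_gcd_eq hqk hJ' (hsol J hJ')]

/-- The characteristic quasi-polynomial. -/
theorem ncard_complMod_eq_sum_beta {q : ℕ} [NeZero q] (hq : 𝒯.q0 < q)
    (hsol : ∀ J, 𝒯.rBar J = 𝒯.r J → vecMod q (𝒯.c J) ∈ colSpaceMod q (𝒯.C J)) :
    ((𝒯.complMod q).ncard : ℤ) = ∑ j ∈ Finset.Icc (𝒯.r ∅) (𝒯.r Finset.univ),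
      (-1) ^ (j - 𝒯.r ∅) * 𝒯.beta j q * (q : ℤ) ^ (n - j) := by
  rw [ncard_complMod, ← Finset.sum_filter_add_sum_filter_not _ (fun J => 𝒯.rBar J = 𝒯.r J)]
  have h0 : ∑ J ∈ Finset.univ.filter fun J : Finset (Fin m) => ¬ 𝒯.rBar J = 𝒯.r J,
      (-1 : ℤ) ^ J.card * (Nat.card {x : Fin n → ZMod q //
        matMod q (𝒯.C J) *ᵥ x = vecMod q (𝒯.c J)} : ℤ) = 0 := by
    refine Finset.sum_eq_zero fun J hJ => ?_
    rw [card_solutions_of_ne 𝒯 q (Finset.mem_filter.mp hJ).2 hq]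
    simp
  rw [h0, add_zero, ← Finset.sum_fiberwise_of_maps_to
    (t := Finset.Icc (𝒯.r ∅) (𝒯.r Finset.univ)) (g := 𝒯.r) fun J _ => Finset.mem_Icc.mpr
      ⟨𝒯.r_mono (Finset.empty_subset _), 𝒯.r_mono (Finset.subset_univ _)⟩]
  refine Finset.sum_congr rfl fun j _ => ?_
  -- The outer sign cancels the sign in the definition of `beta`.
  rw [beta_eq, ← mul_assoc, ← mul_pow, neg_one_mul, neg_neg, one_pow, one_mul, Finset.sum_mul,
    Finset.filter_filter, filter_eq_centralSets]
  refine Finset.sum_congr rfl fun J hJ => ?_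
  rw [mem_centralSets] at hJ
  rw [card_solutions_of_mem 𝒯 q (hsol J hJ.2.1), hJ.2.2]
  push_cast
  ring

/-- The `k`-th constituent of the characteristic quasi-polynomial, written out. -/
noncomputable def constituent (𝒯 : TruncatedArrangement l m n) (k : ℕ) : Polynomial ℚ :=
  ∑ j ∈ Finset.Icc (𝒯.r ∅) (𝒯.r Finset.univ),
    Polynomial.C ((-1) ^ (j - 𝒯.r ∅) * (𝒯.gamma j k : ℚ)) * Polynomial.X ^ (n - j)

/-- Congruent numbers have the same gcd with `ρ_C`, so solvability and the coefficients pass from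
`k` to every `q` of its residue class. -/
theorem isConstituent_constituent {k : ℕ} (hk : 0 < k)
    (hsol : ∀ J, 𝒯.rBar J = 𝒯.r J → vecMod k (𝒯.c J) ∈ colSpaceMod k (𝒯.C J)) :
    𝒯.IsConstituent k (𝒯.constituent k) := by
  intro q hq hmod
  have : NeZero q := ⟨by omega⟩
  have : NeZero k := ⟨by omega⟩
  have hgcd : k.gcd 𝒯.rho = q.gcd 𝒯.rho := hmod.symm.gcd_eq
  have hsol' : ∀ J, 𝒯.rBar J = 𝒯.r J → vecMod q (𝒯.c J) ∈ colSpaceMod q (𝒯.C J) :=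
    fun J hJ => solvable_of_gcd_eq hk hgcd hJ (hsol J hJ)
  have h1 : ((𝒯.complMod q).ncard : ℚ) = (((𝒯.complMod q).ncard : ℤ) : ℚ) := by simp
  rw [h1, ncard_complMod_eq_sum_beta hq hsol', constituent, Polynomial.eval_finsetSum]
  push_cast
  refine Finset.sum_congr rfl fun j _ => ?_
  rw [gamma_eq_beta, beta_eq_of_gcd_eq hgcd hsol]
  simp

theorem IsConstituent.unique {k : ℕ} (hrho : 0 < 𝒯.rho) {f g : Polynomial ℚ}
    (hf : 𝒯.IsConstituent k f) (hg : 𝒯.IsConstituent k g) : f = g := by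
  refine Polynomial.eq_of_infinite_eval_eq f g ?_
  -- Infinitely many members of the residue class, all beyond `q₀`, at which both polynomials are
  -- prescribed.
  have hinj : Function.Injective fun t : ℕ => ((k + 𝒯.rho * (t + 𝒯.q0 + 1) : ℕ) : ℚ) := by
    intro s t hst
    have h1 : k + 𝒯.rho * (s + 𝒯.q0 + 1) = k + 𝒯.rho * (t + 𝒯.q0 + 1) :=
      Nat.cast_injective (R := ℚ) hst
    have h2 := Nat.eq_of_mul_eq_mul_left hrho (Nat.add_left_cancel h1)
    omega
  refine (Set.infinite_range_of_injective hinj).mono ?_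
  rintro _ ⟨t, rfl⟩
  have h1 : 𝒯.q0 < k + 𝒯.rho * (t + 𝒯.q0 + 1) := by nlinarith
  have h2 : k + 𝒯.rho * (t + 𝒯.q0 + 1) ≡ k [MOD 𝒯.rho] := by simp [Nat.ModEq]
  exact (hf _ h1 h2).trans (hg _ h1 h2).symm

theorem coeff_constituent (k : ℕ) {j : ℕ} (hj : 𝒯.r ∅ ≤ j) (hj' : j ≤ 𝒯.r Finset.univ) :
    (𝒯.constituent k).coeff (n - j) = (-1) ^ (j - 𝒯.r ∅) * (𝒯.gamma j k : ℚ) := by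
  have hn := 𝒯.r_le Finset.univ
  rw [constituent, Polynomial.finsetSum_coeff, Finset.sum_eq_single j]
  · rw [Polynomial.coeff_C_mul_X_pow, if_pos rfl]
  · intro i hi hij
    rw [Finset.mem_Icc] at hi
    rw [Polynomial.coeff_C_mul_X_pow, if_neg (by omega)]
  · intro h
    exact absurd (Finset.mem_Icc.mpr ⟨hj, hj'⟩) h

end Constituent

/-- Positivity of `q` suffices here: the bound `q₀` concerns point counts, which enter only through
`IsConstituent`. Both parts of the theorem are therefore instances. -/
theorem coefficients_and_constituent
    {prec : AffineSubspace ℝ (Fin n → ℝ) → AffineSubspace ℝ (Fin n → ℝ) → Prop}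
    (hV : (𝒯.V : Set (Fin n → ℝ)).Nonempty)
    (hH : ∀ i : Fin m, IsCodimOne (𝒯.H i) 𝒯.V)
    (hprec : IsStrictTotalOrder (AffineSubspace ℝ (Fin n → ℝ)) prec) {q k : ℕ}
    (hq : 0 < q) (hk : 1 ≤ k) (hkrho : k ≤ 𝒯.rho) (hqk : q.gcd 𝒯.rho = k.gcd 𝒯.rho)
    (hsol : ∀ J, 𝒯.rBar J = 𝒯.r J → vecMod q (𝒯.c J) ∈ colSpaceMod q (𝒯.C J)) :
    (∀ j : ℕ, 𝒯.r ∅ ≤ j → j ≤ 𝒯.r Finset.univ →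
      0 < 𝒯.w prec j ∧ (𝒯.w prec j : ℤ) = 𝒯.gamma j 1 ∧
        𝒯.gamma j 1 ≤ 𝒯.gamma j k ∧ 𝒯.gamma j k = 𝒯.beta j q) ∧
    (∃! f : Polynomial ℚ, 𝒯.IsConstituent k f) ∧
    (∀ f : Polynomial ℚ, 𝒯.IsConstituent k f →
      f = ∑ j ∈ Finset.Icc (𝒯.r ∅) (𝒯.r Finset.univ),
        Polynomial.C ((-1) ^ (j - 𝒯.r ∅) * (𝒯.gamma j k : ℚ)) * Polynomial.X ^ (n - j) ∧
      ∀ j : ℕ, 𝒯.r ∅ ≤ j → j ≤ 𝒯.r Finset.univ →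
        0 < (-1) ^ (j - 𝒯.r ∅) * f.coeff (n - j)) := by
  have : NeZero q := ⟨hq.ne'⟩
  have : NeZero k := ⟨by omega⟩
  have hrho : 0 < 𝒯.rho := by omega
  have hgamma : ∀ j, 𝒯.gamma j k = 𝒯.beta j q := fun j =>
    (beta_eq_of_gcd_eq hqk hsol j).symm
  have hcoef : ∀ j : ℕ, 𝒯.r ∅ ≤ j → j ≤ 𝒯.r Finset.univ →
      0 < 𝒯.w prec j ∧ (𝒯.w prec j : ℤ) = 𝒯.gamma j 1 ∧
        𝒯.gamma j 1 ≤ 𝒯.gamma j k ∧ 𝒯.gamma j k = 𝒯.beta j q := fun j hj hj' =>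
    ⟨w_pos hV hH hprec hj hj', w_eq_gamma_one hV hH hprec hj,
      (gamma_one_le_beta hV hH hprec hsol hj).trans_eq (hgamma j).symm, hgamma j⟩
  have hcons := isConstituent_constituent (𝒯 := 𝒯) (k := k) hk
    fun J hJ => solvable_of_gcd_eq hq hqk hJ (hsol J hJ)
  refine ⟨hcoef, ⟨_, hcons, fun g hg => hg.unique hrho hcons⟩, fun f hf => ?_⟩
  obtain rfl := hf.unique hrho hcons
  refine ⟨rfl, fun j hj hj' => ?_⟩
  obtain ⟨h1, h2, h3, -⟩ := hcoef j hj hj'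
  rw [coeff_constituent k hj hj', ← mul_assoc, ← mul_pow, neg_one_mul, neg_neg, one_pow, one_mul]
  have : 0 < 𝒯.gamma j k := by omega
  exact_mod_cast this

end TruncatedArrangement

theorem corollary3p9 {l m n : ℕ} (𝒯 : TruncatedArrangement l m n)
    (hV : (𝒯.V : Set (Fin n → ℝ)).Nonempty)
    (hH : ∀ i : Fin m, IsCodimOne (𝒯.H i) 𝒯.V)
    (prec : AffineSubspace ℝ (Fin n → ℝ) → AffineSubspace ℝ (Fin n → ℝ) → Prop)
    (hprec : IsStrictTotalOrder (AffineSubspace ℝ (Fin n → ℝ)) prec) :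
    (∀ q k : ℕ, 𝒯.q0 < q → 1 ≤ k → k ≤ 𝒯.rho → q.gcd 𝒯.rho = k.gcd 𝒯.rho →
      (∀ J : Finset (Fin m), 𝒯.rBar J = 𝒯.r J →
        vecMod q (𝒯.c J) ∈ colSpaceMod q (𝒯.C J)) →
      (∀ j : ℕ, 𝒯.r ∅ ≤ j → j ≤ 𝒯.r Finset.univ →
        0 < 𝒯.w prec j ∧ (𝒯.w prec j : ℤ) = 𝒯.gamma j 1 ∧
          𝒯.gamma j 1 ≤ 𝒯.gamma j k ∧ 𝒯.gamma j k = 𝒯.beta j q) ∧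
      (∃! f : Polynomial ℚ, 𝒯.IsConstituent k f) ∧
      (∀ f : Polynomial ℚ, 𝒯.IsConstituent k f →
        f = ∑ j ∈ Finset.Icc (𝒯.r ∅) (𝒯.r Finset.univ),
          Polynomial.C ((-1) ^ (j - 𝒯.r ∅) * (𝒯.gamma j k : ℚ)) * Polynomial.X ^ (n - j) ∧
        ∀ j : ℕ, 𝒯.r ∅ ≤ j → j ≤ 𝒯.r Finset.univ →
          0 < (-1) ^ (j - 𝒯.r ∅) * f.coeff (n - j))) ∧
    (𝒯.a = 0 → 𝒯.b = 0 →
      ∀ q k : ℕ, 0 < q → 1 ≤ k → k ≤ 𝒯.rho → q.gcd 𝒯.rho = k.gcd 𝒯.rho →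
      (∀ j : ℕ, 𝒯.r ∅ ≤ j → j ≤ 𝒯.r Finset.univ →
        0 < 𝒯.w prec j ∧ (𝒯.w prec j : ℤ) = 𝒯.gamma j 1 ∧
          𝒯.gamma j 1 ≤ 𝒯.gamma j k ∧ 𝒯.gamma j k = 𝒯.beta j q) ∧
      (∃! f : Polynomial ℚ, 𝒯.IsConstituent k f) ∧
      (∀ f : Polynomial ℚ, 𝒯.IsConstituent k f →
        f = ∑ j ∈ Finset.Icc (𝒯.r ∅) (𝒯.r Finset.univ),
          Polynomial.C ((-1) ^ (j - 𝒯.r ∅) * (𝒯.gamma j k : ℚ)) * Polynomial.X ^ (n - j) ∧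
        ∀ j : ℕ, 𝒯.r ∅ ≤ j → j ≤ 𝒯.r Finset.univ →
          0 < (-1) ^ (j - 𝒯.r ∅) * f.coeff (n - j))) := by
  refine ⟨fun q k hq hk hkrho hqk hsol =>
    TruncatedArrangement.coefficients_and_constituent hV hH hprec (Nat.zero_lt_of_lt hq) hk hkrho hqk hsol, fun ha hb q k hq hk hkrho hqk =>
    TruncatedArrangement.coefficients_and_constituent hV hH hprec hq hk hkrho hqk fun J _ => ?_⟩
  -- In the homogeneous case every `c_J` is zero and lies in any column module.
  have hc : vecMod q (𝒯.c J) = 0 := by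
    ext (i | i) <;> simp [vecMod, TruncatedArrangement.c, ha, hb]
  rw [hc]
  exact zero_mem _
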